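/- **Definitions.** For $h:\{0,1\}^m\to\mathbb R$, write $\mathbb E_x h(x)=2^{-m}\sum_{x\in\{0,1\}^m}h(x)$, $\|h\|_\infty=\max_x|h(x)|$, and let $\deg(h)$ be the degree of the unique multilinear real polynomial agreeing with $h$ on $\{0,1\}^m$. A function $f:\{0,1\}^m\to\mathbb R$ with $f\ge 0$ has a *degree-$k$ sos certificate* if $f=\sum_{j=1}^t g_j^2$ on $\{0,1\}^m$ for some $t$ and some $g_1,\dots,g_t:\{0,1\}^m\to\mathbb R$ with $\deg(g_j)\le k/2$; the *sos degree* $\deg_{\mathsf{sos}}(f)$ is the least integer $k\ge 0$ for which such a certificate exists. A *degree-$d$ pseudo-density* is a function $D:\{0,1\}^m\to\mathbb R$ with $\mathbb E_xD(x)=1$ and $\mathbb E_xD(x)g(x)^2\ge 0$ for all $g:\{0,1\}^m\to\mathbb R$ with $\deg(g)\le d/2$. The *psd rank* $\mathrm{rk}_{\mathsf{psd}}(M)$ of an entrywise nonnegative matrix $M\in\mathbb R^{p\times q}$ is the least $r$ for which there are real symmetric positive semidefinite $r\times r$ matrices $A_1,\dots,A_p,B_1,\dots,B_q$ with $M_{ij}=\operatorname{Tr}(A_iB_j)$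 for all $i,j$. For $f:\{0,1\}^m\to[0,1]$ and $n\ge m$, let $M_n^f$ be the $\binom nm\times 2^n$ matrix $M_n^f(S,x)=f(x_S)$, where $S=\{i_1<\dots<i_m\}$ runs over the $m$-element subsets of $\{1,\dots,n\}$, $x$ runs over $\{0,1\}^n$, and $x_S=(x_{i_1},\dots,x_{i_m})$. Finally, $\log$ is the natural logarithm. **Theorem.** (1) Let $m,d\ge 1$ be integers and let $f:\{0,1\}^m\to[0,1]$ satisfy $\deg_{\mathsf{sos}}(f)=d+2$. Then there is a constant $C_f>0$, depending only on $f$, such that for every integer $n\ge 2m$, $$1+n^{1+d/2}\;\ge\;\mathrm{rk}_{\mathsf{psd}}(M_n^f)\;\ge\;C_f\left(\frac{n}{\log n}\right)^{d/4}.$$ (2) There is a universal constant $c>0$ such that the following holds. Let $m,d\ge 1$ be integers, $f:\{0,1\}^m\to[0,1]$ and $\varepsilon\in(0,1]$, and suppose that $D:\{0,1\}^m\to\mathbb R$ is a degree-$d$ pseudo-density with $\mathbb E_xD(x)f(x)<-\varepsilon$. Then for every integer $n\ge 2m$, $$\mathrm{rk}_{\mathsf{psd}}(M_n^f)\;\ge\;\left(\frac{c\,\varepsilon\,n}{d\,m^2\,\|D\|_\infty\log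 n}\right)^{d/4}\left(\frac{\varepsilon}{\|D\|_\infty}\right)^{3/2}\sqrt{\mathbb E_xf(x)}\,.$$ -/

import Mathlib

open Finset
open scoped BigOperators Matrix

noncomputable section

/-- The discrete cube `{0,1}^n`; `true` is `1` and `false` is `0`. -/
abbrev Cube (n : ℕ) : Type := Fin n → Bool

/-- The character `χ_S(x) = ∏_{i ∈ S} (2 x_i - 1)`, that is, the monomial `∏_{i ∈ S} y_i` under
the identification `y = 2 x - 1` of `{0,1}^n` with `{-1,1}^n`. -/
def cubeChar {n : ℕ} (S : Finset (Fin n)) (x : Cube n) : ℝ :=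
  ∏ i ∈ S, (if x i then (1 : ℝ) else -1)

/-- The Fourier coefficient `𝔼_x f(x) χ_S(x)`. -/
def cubeFourier {n : ℕ} (f : Cube n → ℝ) (S : Finset (Fin n)) : ℝ :=
  𝔼 x : Cube n, f x * cubeChar S x

open Classical in
/-- The degree of `f : {0,1}^n → ℝ` as a multilinear polynomial: the largest `|S|` with a nonzero
Fourier coefficient at `S` (and `0` for `f = 0`). -/
def cubeDegree {n : ℕ} (f : Cube n → ℝ) : ℕ :=
  (Finset.univ.filter (fun S : Finset (Fin n) => cubeFourier f S ≠ 0)).sup Finset.card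

/-- `f` is a finite sum of squares of functions `g` with `deg g ≤ d / 2`. -/
def HasSosCertificate {m : ℕ} (f : Cube m → ℝ) (d : ℕ) : Prop :=
  ∃ (k : ℕ) (g : Fin k → Cube m → ℝ),
    (∀ j, 2 * cubeDegree (g j) ≤ d) ∧ ∀ x, f x = ∑ j, g j x ^ 2

/-- The sos degree of `f`: the least `d` such that `f` has a degree-`d` sos certificate. -/
def sosDegree {m : ℕ} (f : Cube m → ℝ) : ℕ :=
  sInf {d : ℕ | HasSosCertificate f d}

/-- A degree-`d` pseudo-density: `𝔼 D = 1` and `𝔼 D g² ≥ 0` whenever `deg g ≤ d / 2`. -/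
structure IsPseudoDensity {m : ℕ} (d : ℕ) (D : Cube m → ℝ) : Prop where
  expect_eq_one : 𝔼 x : Cube m, D x = 1
  expect_sq_nonneg : ∀ g : Cube m → ℝ, 2 * cubeDegree g ≤ d → 0 ≤ 𝔼 x : Cube m, D x * g x ^ 2

/-- A rank-`r` psd factorization `M i j = Tr (A i * B j)` with psd `r × r` real matrices. -/
def HasPsdFactorization {I J : Type*} (M : Matrix I J ℝ) (r : ℕ) : Prop :=
  ∃ (A : I → Matrix (Fin r) (Fin r) ℝ) (B : J → Matrix (Fin r) (Fin r) ℝ),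
    (∀ i, (A i).PosSemidef) ∧ (∀ j, (B j).PosSemidef) ∧ ∀ i j, M i j = (A i * B j).trace

/-- The psd rank of `M`: the least `r` such that `M` has a rank-`r` psd factorization. -/
def psdRank {I J : Type*} (M : Matrix I J ℝ) : ℕ :=
  sInf {r : ℕ | HasPsdFactorization M r}

/-- The `m`-element subsets of `[n]`. -/
abbrev SubsetOfCard (n m : ℕ) : Type := {S : Finset (Fin n) // S.card = m}

/-- The restriction `x_S = (x_{i_1}, …, x_{i_m})`, where `S = {i_1 < ⋯ < i_m}`. -/
def cubeRestrict {n m : ℕ} (S : SubsetOfCard n m) (x : Cube n) : Cube m :=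
  fun j => x (S.1.orderEmbOfFin S.2 j)

/-- The matrix `M_n^f(S, x) = f(x_S)`. -/
def restrictionMatrix {m : ℕ} (n : ℕ) (f : Cube m → ℝ) : Matrix (SubsetOfCard n m) (Cube n) ℝ :=
  Matrix.of fun S x => f (cubeRestrict S x)

/-- The minimum defining `sosDegree` is attained: a nonnegative `f` has a certificate. -/
theorem exists_hasSosCertificate {m : ℕ} (f : Cube m → ℝ) (hf : ∀ x, 0 ≤ f x) :
    ∃ d, HasSosCertificate f d :=
  ⟨2 * cubeDegree (fun x => √(f x)), 1, fun _ x => √(f x), fun _ => le_rfl,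
    fun x => by simp [Real.sq_sqrt (hf x)]⟩

/-- The minimum defining `psdRank` is attained for nonnegative matrices with finitely many rows. -/
theorem exists_hasPsdFactorization {I J : Type*} [Fintype I] (M : Matrix I J ℝ)
    (hM : ∀ i j, 0 ≤ M i j) : ∃ r, HasPsdFactorization M r := by
  classical
  let e := Fintype.equivFin I
  refine ⟨Fintype.card I, fun i => Matrix.diagonal (Pi.single (e i) 1),
    fun j => Matrix.diagonal (fun k => M (e.symm k) j), fun i => ?_, fun j => ?_, fun i j => ?_⟩
  · refine Matrix.PosSemidef.diagonal fun k => ?_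
    by_cases h : k = e i
    · subst h; simp
    · simp [h]
  · exact Matrix.PosSemidef.diagonal fun k => hM _ _
  · simp [Matrix.diagonal_mul_diagonal, Matrix.trace_diagonal, Pi.single_apply]

end

/-! ### Fourier analysis on the cube -/

/-! Upper bound. A degree-`(d + 2)` certificate writes `f(x_S)` as a psd quadratic form in the
vector of characters of degree at most `(d + 2) / 2` at `x`. This is a psd factorization with
rank-one right factors, of size the number of such characters
(`hasPsdFactorization_of_hasSosCertificate`).

Lower bound from a pseudo-density `D` with `|D| ≤ Δ`. Let `f(x_S) = Tr(A_S B_x)` with matrices of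
size `r`, and put `W(x) = 𝔼_S D(x_S) A_S`. Then `𝔼_x Tr(W(x) B_x) = 𝔼 D f < -ε`. If `B_x` had the
form `R(x) R(x)ᵀ` with `R` of low degree, the same average would be almost nonnegative: `Tr(A_S R
Rᵀ)` is a sum of squares, a character of low degree rarely meets a random `S` in more than `d / 2`
points, and `D` is nonnegative on squares of degree at most `d / 2` in the variables of `S`
(`IsPseudoDensity.expect_expect_trace_ge`).

Nothing makes `B_x` of low degree, so it is replaced by `V(x) ^ (2k)`, where `V = 2Δ·1 - W` is psd
with entries of degree at most `m`. With `μ = 𝔼 f` and `s = ε / (Δμ)`, the existence of `B` shows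
that `V` has average at least `Δ(2 + s)` under some bounded density. As in the power method, its
average under the weight `V ^ (2k)` is then at least `Δ(2 + s/2)`, once `k` is of order `log(r/μ) /
s` (`mul_expect_trace_pow_le`). Hence `W` has average at most `-Δs/2` under that weight, and
comparison with the previous paragraph gives `s² ≤ 144 r (k m² / n) ^ (d/2 + 1)`
(`sq_le_of_hasPsdFactorization`). A `k` of order `d Δ log n / ε` yields the bound.

The argument needs `𝔼_S A_S ≤ 2·1`, `Tr A_S ≤ 4r` and `Tr B_x ≤ 1`; maximizing a determinant over a
simplex provides a change of basis achieving this (`exists_normalized_factorization`). The lower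
bound of the first part follows from the second: without a degree-`d` certificate, convex separation
produces a suitable `D` (`exists_isPseudoDensity`). -/

theorem cubeChar_empty {n : ℕ} (x : Cube n) : cubeChar ∅ x = 1 := by simp [cubeChar]

theorem cubeChar_eq_prod {n : ℕ} (S : Finset (Fin n)) (x : Cube n) :
    cubeChar S x = ∏ i, if i ∈ S then (if x i then (1 : ℝ) else -1) else 1 := by
  rw [cubeChar, Finset.prod_ite_mem, Finset.univ_inter]

theorem cubeChar_mul {n : ℕ} (S T : Finset (Fin n)) (x : Cube n) :
    cubeChar S x * cubeChar T x = cubeChar (symmDiff S T) x := by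
  simp only [cubeChar_eq_prod, ← Finset.prod_mul_distrib, Finset.mem_symmDiff]
  refine Finset.prod_congr rfl fun i _ => ?_
  by_cases h1 : i ∈ S <;> by_cases h2 : i ∈ T <;> cases x i <;> simp [h1, h2]

theorem expect_cubeChar {n : ℕ} (S : Finset (Fin n)) :
    𝔼 x : Cube n, cubeChar S x = if S = ∅ then 1 else 0 := by
  split_ifs with h
  · subst h; simp [cubeChar_empty]
  · obtain ⟨i, hi⟩ := Finset.nonempty_iff_ne_empty.mpr h
    have key : ∑ x : Cube n, cubeChar S x = 0 := by
      simp only [cubeChar_eq_prod]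
      rw [← Fintype.prod_sum (fun (i : Fin n) (b : Bool) =>
        if i ∈ S then (if b then (1 : ℝ) else -1) else 1)]
      exact Finset.prod_eq_zero (Finset.mem_univ i) (by simp [hi])
    rw [Fintype.expect_eq_sum_div_card, key, zero_div]

theorem expect_cubeChar_mul {n : ℕ} (S T : Finset (Fin n)) :
    𝔼 x : Cube n, cubeChar S x * cubeChar T x = if S = T then 1 else 0 := by
  simp only [cubeChar_mul, expect_cubeChar]
  congr 1
  rw [← Finset.bot_eq_empty, symmDiff_eq_bot]

theorem sum_cubeChar_mul {n : ℕ} (x y : Cube n) :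
    ∑ S, cubeChar S x * cubeChar S y = if x = y then (2 : ℝ) ^ n else 0 := by
  have h : ∑ S, cubeChar S x * cubeChar S y
      = ∏ i, (1 + (if x i then (1 : ℝ) else -1) * (if y i then (1 : ℝ) else -1)) := by
    rw [Finset.prod_one_add, Finset.powerset_univ]
    simp only [cubeChar, Finset.prod_mul_distrib]
  rw [h]
  split_ifs with hxy
  · subst hxy
    have : ∀ i, (1 + (if x i then (1 : ℝ) else -1) * (if x i then (1 : ℝ) else -1)) = 2 := by
      intro i; cases x i <;> norm_num
    rw [Finset.prod_congr rfl fun i _ => this i]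
    simp
  · obtain ⟨i, hi⟩ := Function.ne_iff.mp hxy
    refine Finset.prod_eq_zero (Finset.mem_univ i) ?_
    revert hi
    cases x i <;> cases y i <;> norm_num

/-- Fourier inversion. -/
theorem sum_cubeFourier_mul_cubeChar {n : ℕ} (f : Cube n → ℝ) (x : Cube n) :
    ∑ S, cubeFourier f S * cubeChar S x = f x := by
  simp only [cubeFourier, Finset.expect_mul]
  rw [← Finset.expect_sum_comm]
  simp only [mul_assoc, ← Finset.mul_sum, sum_cubeChar_mul]
  rw [Fintype.expect_eq_sum_div_card]
  simp

theorem cubeFourier_sum_mul_cubeChar {n : ℕ} (c : Finset (Fin n) → ℝ) (T : Finset (Fin n)) :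
    cubeFourier (fun x => ∑ S, c S * cubeChar S x) T = c T := by
  simp only [cubeFourier, Finset.sum_mul]
  rw [Finset.expect_sum_comm]
  simp only [mul_assoc, ← Finset.mul_expect, expect_cubeChar_mul]
  simp

/-- Parseval's identity. -/
theorem expect_sq_eq_sum_cubeFourier_sq {n : ℕ} (f : Cube n → ℝ) :
    𝔼 x, f x ^ 2 = ∑ S, cubeFourier f S ^ 2 := by
  have h : ∀ x, f x ^ 2 = ∑ S, cubeFourier f S * (f x * cubeChar S x) := by
    intro x
    conv_lhs => rw [sq]; rhs; rw [← sum_cubeFourier_mul_cubeChar f x]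
    rw [Finset.mul_sum]
    exact Finset.sum_congr rfl fun S _ => by ring
  simp only [h]
  rw [Finset.expect_sum_comm]
  simp only [← Finset.mul_expect, sq]
  rfl

theorem cubeFourier_sum {n : ℕ} {ι : Type*} (s : Finset ι) (f : ι → Cube n → ℝ)
    (T : Finset (Fin n)) :
    cubeFourier (fun x => ∑ i ∈ s, f i x) T = ∑ i ∈ s, cubeFourier (f i) T := by
  simp only [cubeFourier, Finset.sum_mul]
  rw [Finset.expect_sum_comm]

theorem cubeFourier_expect {n : ℕ} {ι : Type*} (s : Finset ι) (f : ι → Cube n → ℝ)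
    (T : Finset (Fin n)) :
    cubeFourier (fun x => 𝔼 i ∈ s, f i x) T = 𝔼 i ∈ s, cubeFourier (f i) T := by
  simp only [cubeFourier, Finset.expect_mul]
  rw [Finset.expect_comm]

theorem cubeFourier_const_mul {n : ℕ} (c : ℝ) (f : Cube n → ℝ) (T : Finset (Fin n)) :
    cubeFourier (fun x => c * f x) T = c * cubeFourier f T := by
  simp only [cubeFourier, mul_assoc, ← Finset.mul_expect]

theorem cubeFourier_cubeChar {n : ℕ} (S T : Finset (Fin n)) :
    cubeFourier (cubeChar S) T = if S = T then 1 else 0 :=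
  expect_cubeChar_mul S T

/-- `f` is a multilinear polynomial of degree at most `k`. -/
def CubeDegreeLE {n : ℕ} (k : ℕ) (f : Cube n → ℝ) : Prop :=
  ∀ T : Finset (Fin n), k < #T → cubeFourier f T = 0

theorem cubeDegree_le_iff {n k : ℕ} {f : Cube n → ℝ} : cubeDegree f ≤ k ↔ CubeDegreeLE k f := by
  classical
  simp only [cubeDegree, Finset.sup_le_iff, Finset.mem_filter, Finset.mem_univ, true_and,
    CubeDegreeLE]
  exact forall_congr' fun T => by rw [← not_lt, not_imp_comm, not_not]

theorem two_mul_cubeDegree_le_iff {n d : ℕ} {f : Cube n → ℝ} :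
    2 * cubeDegree f ≤ d ↔ CubeDegreeLE (d / 2) f := by
  rw [← cubeDegree_le_iff]; omega

namespace CubeDegreeLE

variable {n : ℕ}

theorem of_card_le {k : ℕ} {S : Finset (Fin n)} (h : #S ≤ k) : CubeDegreeLE k (cubeChar S) := by
  intro T hT
  rw [cubeFourier_cubeChar, if_neg]
  rintro rfl
  omega

theorem sum {k : ℕ} {ι : Type*} {s : Finset ι} {f : ι → Cube n → ℝ}
    (hf : ∀ i ∈ s, CubeDegreeLE k (f i)) : CubeDegreeLE k (fun x => ∑ i ∈ s, f i x) := by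
  intro T hT
  rw [cubeFourier_sum]
  exact Finset.sum_eq_zero fun i hi => hf i hi T hT

theorem expect {k : ℕ} {ι : Type*} {s : Finset ι} {f : ι → Cube n → ℝ}
    (hf : ∀ i ∈ s, CubeDegreeLE k (f i)) : CubeDegreeLE k (fun x => 𝔼 i ∈ s, f i x) := by
  intro T hT
  rw [cubeFourier_expect]
  exact Finset.expect_eq_zero fun i hi => hf i hi T hT

theorem const_mul {k : ℕ} (c : ℝ) {f : Cube n → ℝ} (hf : CubeDegreeLE k f) :
    CubeDegreeLE k (fun x => c * f x) := by
  intro T hT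
  rw [cubeFourier_const_mul, hf T hT, mul_zero]

theorem const {k : ℕ} (c : ℝ) : CubeDegreeLE k (fun _ : Cube n => c) := by
  have h := const_mul c (of_card_le (n := n) (S := ∅) (k := k) (by simp))
  simpa [cubeChar_empty] using h

theorem add {k : ℕ} {f g : Cube n → ℝ} (hf : CubeDegreeLE k f) (hg : CubeDegreeLE k g) :
    CubeDegreeLE k (fun x => f x + g x) := by
  intro T hT
  have hf := hf T hT
  have hg := hg T hT
  rw [cubeFourier] at *
  simp only [add_mul, Finset.expect_add_distrib, hf, hg, add_zero]

theorem sub {k : ℕ} {f g : Cube n → ℝ} (hf : CubeDegreeLE k f) (hg : CubeDegreeLE k g) :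
    CubeDegreeLE k (fun x => f x - g x) := by
  simpa [sub_eq_add_neg] using hf.add (hg.const_mul (-1))

theorem mul {k l : ℕ} {f g : Cube n → ℝ} (hf : CubeDegreeLE k f) (hg : CubeDegreeLE l g) :
    CubeDegreeLE (k + l) (fun x => f x * g x) := by
  have h : (fun x => f x * g x) = fun x => ∑ S, ∑ T, (cubeFourier f S * cubeFourier g T) *
      cubeChar (symmDiff S T) x := by
    funext x
    rw [← sum_cubeFourier_mul_cubeChar f x, ← sum_cubeFourier_mul_cubeChar g x,
      Finset.sum_mul_sum]
    refine Finset.sum_congr rfl fun S _ => Finset.sum_congr rfl fun T _ => ?_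
    rw [← cubeChar_mul]; ring
  rw [h]
  refine sum fun S _ => sum fun T _ => ?_
  by_cases hS : k < #S
  · simpa [hf S hS] using const (n := n) (k := k + l) 0
  by_cases hT : l < #T
  · simpa [hg T hT] using const (n := n) (k := k + l) 0
  refine const_mul _ (of_card_le ?_)
  have h1 : #(symmDiff S T) ≤ #(S ∪ T) := Finset.card_le_card (by
    intro i; simp only [Finset.mem_symmDiff, Finset.mem_union]; tauto)
  have h2 := Finset.card_union_le S T
  omega

end CubeDegreeLE

theorem cubeDegreeLE_self {n : ℕ} (f : Cube n → ℝ) : CubeDegreeLE n f := by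
  intro T hT
  exact absurd (Finset.card_le_univ T) (by simpa using hT)

/-! ### Restriction to a subset of the coordinates -/

theorem cubeChar_cubeRestrict {n m : ℕ} (S : SubsetOfCard n m) (U : Finset (Fin m)) (x : Cube n) :
    cubeChar U (cubeRestrict S x) = cubeChar (U.map (S.1.orderEmbOfFin S.2).toEmbedding) x := by
  rw [cubeChar, cubeChar, Finset.prod_map]
  rfl

theorem CubeDegreeLE.comp_cubeRestrict {n m k : ℕ} {f : Cube m → ℝ} (hf : CubeDegreeLE k f)
    (S : SubsetOfCard n m) : CubeDegreeLE k (fun x => f (cubeRestrict S x)) := by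
  have h : (fun x => f (cubeRestrict S x)) = fun x => ∑ U, cubeFourier f U *
      cubeChar (U.map (S.1.orderEmbOfFin S.2).toEmbedding) x := by
    funext x
    simp only [← cubeChar_cubeRestrict, sum_cubeFourier_mul_cubeChar]
  rw [h]
  refine CubeDegreeLE.sum fun U _ => ?_
  by_cases hU : k < #U
  · simpa [hf U hU] using CubeDegreeLE.const (n := n) (k := k) 0
  · exact CubeDegreeLE.const_mul _ (CubeDegreeLE.of_card_le (by simpa using hU))

/-- Splitting the coordinates of a point into those in `S` and those outside `S`. -/
def cubeSplit {n m : ℕ} (S : SubsetOfCard n m) :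
    Cube n ≃ Cube m × ({i // i ∉ S.1} → Bool) :=
  (Equiv.piEquivPiSubtypeProd (fun i => i ∈ S.1) fun _ => Bool).trans
    (Equiv.prodCongr (Equiv.arrowCongr (S.1.orderIsoOfFin S.2).symm.toEquiv (Equiv.refl Bool))
      (Equiv.refl _))

theorem cubeSplit_fst {n m : ℕ} (S : SubsetOfCard n m) (x : Cube n) :
    (cubeSplit S x).1 = cubeRestrict S x := by
  funext j
  simp [cubeSplit, cubeRestrict, Equiv.arrowCongr]

theorem cubeRestrict_cubeSplit_symm {n m : ℕ} (S : SubsetOfCard n m) (y : Cube m)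
    (z : {i // i ∉ S.1} → Bool) : cubeRestrict S ((cubeSplit S).symm (y, z)) = y := by
  rw [← cubeSplit_fst, Equiv.apply_symm_apply]

theorem cubeSplit_symm_apply_of_notMem {n m : ℕ} (S : SubsetOfCard n m) (y : Cube m)
    (z : {i // i ∉ S.1} → Bool) (i : Fin n) (hi : i ∉ S.1) :
    (cubeSplit S).symm (y, z) i = z ⟨i, hi⟩ := by
  have h : (cubeSplit S ((cubeSplit S).symm (y, z))).2 = z := by rw [Equiv.apply_symm_apply]
  exact congrFun h ⟨i, hi⟩

theorem expect_eq_expect_cubeSplit {n m : ℕ} (S : SubsetOfCard n m) (F : Cube n → ℝ) :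
    𝔼 x, F x = 𝔼 z : {i // i ∉ S.1} → Bool, 𝔼 y : Cube m, F ((cubeSplit S).symm (y, z)) := by
  rw [← Finset.expect_product']
  refine Fintype.expect_equiv ((cubeSplit S).trans (Equiv.prodComm _ _)) _ _ fun x => ?_
  simp

theorem expect_comp_cubeRestrict {n m : ℕ} (S : SubsetOfCard n m) (f : Cube m → ℝ) :
    𝔼 x, f (cubeRestrict S x) = 𝔼 y, f y := by
  rw [expect_eq_expect_cubeSplit S]
  simp only [cubeRestrict_cubeSplit_symm]
  simp

/-- Once the coordinates outside `S` are frozen, the character of `T` becomes a sign times the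
character of `T ∩ S`. -/
theorem cubeDegreeLE_comp_cubeSplit_symm {n m k : ℕ} (S : SubsetOfCard n m)
    (z : {i // i ∉ S.1} → Bool) {g : Cube n → ℝ}
    (hg : ∀ T, k < #(T ∩ S.1) → cubeFourier g T = 0) :
    CubeDegreeLE k (fun y => g ((cubeSplit S).symm (y, z))) := by
  have h : (fun y => g ((cubeSplit S).symm (y, z))) = fun y => ∑ T, (cubeFourier g T *
      ∏ i ∈ (T \ S.1).attach, if z ⟨i, (Finset.mem_sdiff.mp i.2).2⟩ then (1 : ℝ) else -1) *
        cubeChar (Finset.univ.filter fun j => S.1.orderEmbOfFin S.2 j ∈ T) y := by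
    funext y
    rw [← sum_cubeFourier_mul_cubeChar g]
    refine Finset.sum_congr rfl fun T _ => ?_
    rw [mul_assoc]
    congr 1
    have h1 : cubeChar (Finset.univ.filter fun j => S.1.orderEmbOfFin S.2 j ∈ T) y =
        cubeChar (T ∩ S.1) ((cubeSplit S).symm (y, z)) := by
      conv_lhs => rw [← cubeRestrict_cubeSplit_symm S y z]
      rw [cubeChar_cubeRestrict]
      congr 1
      ext i
      simp only [Finset.mem_map, Finset.mem_filter, Finset.mem_univ, true_and,
        Finset.mem_inter, RelEmbedding.coe_toEmbedding]
      constructor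
      · rintro ⟨j, hj, rfl⟩
        exact ⟨hj, Finset.orderEmbOfFin_mem _ _ _⟩
      · rintro ⟨hT, hS⟩
        rw [← Finset.mem_coe, ← Finset.range_orderEmbOfFin S.1 S.2] at hS
        obtain ⟨j, rfl⟩ := hS
        exact ⟨j, hT, rfl⟩
    rw [h1, cubeChar, cubeChar, ← Finset.prod_inter_mul_prod_sdiff T S.1, mul_comm]
    congr 1
    rw [← Finset.prod_attach]
    refine Finset.prod_congr rfl fun i _ => ?_
    rw [cubeSplit_symm_apply_of_notMem]
  rw [h]
  refine CubeDegreeLE.sum fun T _ => ?_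
  by_cases hT : k < #(T ∩ S.1)
  · simpa [hg T hT] using CubeDegreeLE.const (n := m) (k := k) 0
  · refine CubeDegreeLE.const_mul _ (CubeDegreeLE.of_card_le ?_)
    refine le_trans ?_ (not_lt.mp hT)
    refine Finset.card_le_card_of_injOn (S.1.orderEmbOfFin S.2) (fun j hj => ?_)
      (S.1.orderEmbOfFin S.2).injective.injOn
    simp only [Finset.coe_filter, Finset.mem_univ, true_and, Set.mem_ofPred_eq] at hj
    simp [hj]

/-- A pseudo-density on `S` is nonnegative on squares of functions of low degree in `S`. -/
theorem IsPseudoDensity.expect_restrict_nonneg {n m d : ℕ} {D : Cube m → ℝ}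
    (hD : IsPseudoDensity d D) (S : SubsetOfCard n m) {g : Cube n → ℝ}
    (hg : ∀ T, d / 2 < #(T ∩ S.1) → cubeFourier g T = 0) :
    0 ≤ 𝔼 x, D (cubeRestrict S x) * g x ^ 2 := by
  rw [expect_eq_expect_cubeSplit S]
  refine Finset.expect_nonneg fun z _ => ?_
  simp only [cubeRestrict_cubeSplit_symm]
  exact hD.expect_sq_nonneg _
    (two_mul_cubeDegree_le_iff.mpr (cubeDegreeLE_comp_cubeSplit_symm S z hg))

/-- The part of `g` of degree more than `k` in the variables of `S`. -/
noncomputable def highPart {n : ℕ} (k : ℕ) (S : Finset (Fin n)) (g : Cube n → ℝ) (x : Cube n) : ℝ :=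
  ∑ T, (if k < #(T ∩ S) then cubeFourier g T else 0) * cubeChar T x

theorem cubeFourier_highPart {n : ℕ} (k : ℕ) (S : Finset (Fin n)) (g : Cube n → ℝ)
    (T : Finset (Fin n)) :
    cubeFourier (highPart k S g) T = if k < #(T ∩ S) then cubeFourier g T else 0 :=
  cubeFourier_sum_mul_cubeChar _ T

theorem expect_highPart_sq {n : ℕ} (k : ℕ) (S : Finset (Fin n)) (g : Cube n → ℝ) :
    𝔼 x, highPart k S g x ^ 2 = ∑ T, if k < #(T ∩ S) then cubeFourier g T ^ 2 else 0 := by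
  rw [expect_sq_eq_sum_cubeFourier_sq]
  refine Finset.sum_congr rfl fun T _ => ?_
  rw [cubeFourier_highPart]
  split_ifs <;> simp

/-- With `H` the high part, `(g - H)²` has nonnegative expectation against `D`. The remainder `2gH -
H²` is at most `η g² + (1 + 1/η) H²` in absolute value. -/
theorem IsPseudoDensity.expect_restrict_ge {n m d : ℕ} {D : Cube m → ℝ}
    (hD : IsPseudoDensity d D) {Δ : ℝ} (hΔ : ∀ y, |D y| ≤ Δ) (S : SubsetOfCard n m)
    (g : Cube n → ℝ) {η : ℝ} (hη : 0 < η) :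
    -(Δ * (η * 𝔼 x, g x ^ 2 + (1 + 1 / η) * 𝔼 x, highPart (d / 2) S.1 g x ^ 2)) ≤
      𝔼 x, D (cubeRestrict S x) * g x ^ 2 := by
  set H := highPart (d / 2) S.1 g with hH
  have h1 : 0 ≤ 𝔼 x, D (cubeRestrict S x) * (g x - H x) ^ 2 := by
    refine hD.expect_restrict_nonneg S (g := fun x => g x - H x) fun T hT => ?_
    have : cubeFourier (fun x => g x - H x) T = cubeFourier g T - cubeFourier H T := by
      simp only [cubeFourier, sub_mul, Finset.expect_sub_distrib]
    rw [this, hH, cubeFourier_highPart, if_pos hT, sub_self]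
  have h2 : ∀ x, D (cubeRestrict S x) * (g x - H x) ^ 2 -
      Δ * (η * g x ^ 2 + (1 + 1 / η) * H x ^ 2) ≤ D (cubeRestrict S x) * g x ^ 2 := by
    intro x
    obtain ⟨hl, hu⟩ := abs_le.mp (hΔ (cubeRestrict S x))
    set a := D (cubeRestrict S x)
    have h3 : η * g x ^ 2 + (1 + 1 / η) * H x ^ 2 + (2 * g x * H x - H x ^ 2)
        = η * (g x + H x / η) ^ 2 := by field_simp; ring
    have h4 : η * g x ^ 2 + (1 + 1 / η) * H x ^ 2 - (2 * g x * H x - H x ^ 2)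
        = η * (g x - H x / η) ^ 2 + 2 * H x ^ 2 := by field_simp; ring
    have h5 : 0 ≤ η * (g x + H x / η) ^ 2 := by positivity
    have h6 : 0 ≤ η * (g x - H x / η) ^ 2 + 2 * H x ^ 2 := by positivity
    set u := η * g x ^ 2 + (1 + 1 / η) * H x ^ 2
    set v := 2 * g x * H x - H x ^ 2
    have h7 : a * (g x - H x) ^ 2 = a * g x ^ 2 - a * v := by ring
    rw [h7]
    nlinarith [mul_nonneg (sub_nonneg.mpr hu) (h3 ▸ h5), mul_nonneg (neg_le_iff_add_nonneg.mp hl)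
      (h4 ▸ h6)]
  have h8 := Finset.expect_le_expect (s := Finset.univ) fun x _ => h2 x
  rw [Finset.expect_sub_distrib, ← Finset.mul_expect, Finset.expect_add_distrib,
    ← Finset.mul_expect, ← Finset.mul_expect] at h8
  linarith

/-! ### Intersections with a random subset -/

/-- A fixed `h`-set lies in a random `m`-subset of `[n]` with probability at most `(m / n) ^ h`. The
induction removes one element and uses `m / n ≤ (m + 1) / (n + 1)`. -/
theorem choose_sub_mul_pow_le (h : ℕ) : ∀ {n m : ℕ}, m ≤ n → h ≤ m →
    (n - h).choose (m - h) * n ^ h ≤ n.choose m * m ^ h := by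
  induction h with
  | zero => intro n m _ _; simp
  | succ h ih =>
    intro n m hmn hhm
    obtain ⟨m, rfl⟩ : ∃ k, m = k + 1 := ⟨m - 1, by omega⟩
    obtain ⟨n, rfl⟩ : ∃ k, n = k + 1 := ⟨n - 1, by omega⟩
    have h1 := ih (n := n) (m := m) (by omega) (by omega)
    have h2 := Nat.add_one_mul_choose_eq n m
    simp only [Nat.add_sub_add_right]
    have h3 : (n - h).choose (m - h) * (n + 1) ^ h ≤ n.choose m * (m + 1) ^ h := by
      rcases Nat.eq_zero_or_pos h with rfl | hh
      · simp
      have hn : 0 < n ^ h := pow_pos (by omega) _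
      refine Nat.le_of_mul_le_mul_right ?_ hn
      have h4 : ((n + 1) * m) ^ h ≤ (n * (m + 1)) ^ h := Nat.pow_le_pow_left (by nlinarith) _
      rw [mul_pow, mul_pow] at h4
      calc (n - h).choose (m - h) * (n + 1) ^ h * n ^ h
          = ((n - h).choose (m - h) * n ^ h) * (n + 1) ^ h := by ring
        _ ≤ (n.choose m * m ^ h) * (n + 1) ^ h := Nat.mul_le_mul_right _ h1
        _ = n.choose m * ((n + 1) ^ h * m ^ h) := by ring
        _ ≤ n.choose m * (n ^ h * (m + 1) ^ h) := Nat.mul_le_mul_left _ h4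
        _ = _ := by ring
    calc (n - h).choose (m - h) * (n + 1) ^ (h + 1)
        = (n + 1) * ((n - h).choose (m - h) * (n + 1) ^ h) := by ring
      _ ≤ (n + 1) * (n.choose m * (m + 1) ^ h) := Nat.mul_le_mul_left _ h3
      _ = ((n + 1) * n.choose m) * (m + 1) ^ h := by ring
      _ = _ := by rw [h2]; ring

theorem card_filter_subset_le {n m : ℕ} (U : Finset (Fin n)) :
    #{S : SubsetOfCard n m | U ⊆ S.1} ≤ (n - #U).choose (m - #U) := by
  have h1 : #(Uᶜ.powersetCard (m - #U)) = (n - #U).choose (m - #U) := by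
    rw [Finset.card_powersetCard, Finset.card_compl, Fintype.card_fin]
  rw [← h1]
  refine Finset.card_le_card_of_injOn (fun S => S.1 \ U) (fun S hS => ?_) fun S hS S' hS' h => ?_
  · simp only [Finset.coe_filter, Finset.mem_univ, true_and, Set.mem_ofPred_eq] at hS
    rw [Finset.mem_coe, Finset.mem_powersetCard]
    refine ⟨fun i hi => ?_, ?_⟩
    · simpa using (Finset.mem_sdiff.mp hi).2
    · rw [Finset.card_sdiff_of_subset hS, S.2]
  · simp only [Finset.coe_filter, Finset.mem_univ, true_and, Set.mem_ofPred_eq] at hS hS'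
    refine Subtype.ext ?_
    rw [← Finset.sdiff_union_of_subset hS, ← Finset.sdiff_union_of_subset hS']
    exact congrArg (· ∪ U) h

theorem expect_subset_le {n m : ℕ} (hmn : m ≤ n) (hn : 0 < n) (U : Finset (Fin n)) :
    𝔼 S : SubsetOfCard n m, (if U ⊆ S.1 then (1 : ℝ) else 0) ≤ ((m : ℝ) / n) ^ #U := by
  have hcard : Fintype.card (SubsetOfCard n m) = n.choose m := by simp
  have hpos : 0 < n.choose m := Nat.choose_pos hmn
  rw [Fintype.expect_eq_sum_div_card, Finset.sum_boole, hcard, div_pow,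
    div_le_div_iff₀ (by exact_mod_cast hpos) (by positivity)]
  norm_cast
  rcases le_or_gt #U m with hU | hU
  · calc _ ≤ (n - #U).choose (m - #U) * n ^ #U := Nat.mul_le_mul_right _ (card_filter_subset_le U)
      _ ≤ n.choose m * m ^ #U := choose_sub_mul_pow_le _ hmn hU
      _ = _ := mul_comm _ _
  · have : (Finset.univ.filter fun S : SubsetOfCard n m => U ⊆ S.1) = ∅ := by
      refine Finset.filter_eq_empty_iff.mpr fun S _ hS => ?_
      have := Finset.card_le_card hS
      rw [S.2] at this
      omega
    rw [this]
    simp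

/-- Union bound over the `(k + 1)`-subsets of `T`, of which there are at most `K ^ (k + 1)`. -/
theorem expect_card_inter_gt_le {n m K : ℕ} (k : ℕ) (hmn : m ≤ n) (hn : 0 < n)
    {T : Finset (Fin n)} (hT : #T ≤ K) :
    𝔼 S : SubsetOfCard n m, (if k < #(T ∩ S.1) then (1 : ℝ) else 0) ≤
      ((K : ℝ) * m / n) ^ (k + 1) := by
  have h1 : ∀ S : SubsetOfCard n m, (if k < #(T ∩ S.1) then (1 : ℝ) else 0) ≤
      ∑ U ∈ T.powersetCard (k + 1), if U ⊆ S.1 then (1 : ℝ) else 0 := by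
    intro S
    split_ifs with h
    · obtain ⟨U, hU, hc⟩ := Finset.exists_subset_card_eq (Nat.succ_le_of_lt h)
      rw [Finset.sum_boole]
      have : 0 < #{U ∈ T.powersetCard (k + 1) | U ⊆ S.1} := by
        refine Finset.card_pos.mpr ⟨U, Finset.mem_filter.mpr ⟨?_, hU.trans inter_subset_right⟩⟩
        exact Finset.mem_powersetCard.mpr ⟨hU.trans inter_subset_left, hc⟩
      exact_mod_cast this
    · exact Finset.sum_nonneg fun U _ => by split_ifs <;> norm_num
  refine (Finset.expect_le_expect fun S _ => h1 S).trans ?_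
  rw [Finset.expect_sum_comm]
  calc _ ≤ ∑ U ∈ T.powersetCard (k + 1), ((m : ℝ) / n) ^ (k + 1) := by
        refine Finset.sum_le_sum fun U hU => ?_
        rw [← (Finset.mem_powersetCard.mp hU).2]
        exact expect_subset_le hmn hn U
    _ = ((#T).choose (k + 1) : ℝ) * ((m : ℝ) / n) ^ (k + 1) := by
        rw [Finset.sum_const, Finset.card_powersetCard, nsmul_eq_mul]
    _ ≤ (K : ℝ) ^ (k + 1) * ((m : ℝ) / n) ^ (k + 1) := by
        gcongr
        exact_mod_cast (Nat.choose_le_pow _ _).trans (Nat.pow_le_pow_left hT _)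
    _ = _ := by rw [← mul_pow, mul_div_assoc]

/-! ### Real positive semidefinite matrices -/

namespace Matrix

variable {ι : Type*} [Fintype ι]

theorem IsHermitian.exists_orthogonal_diagonal [DecidableEq ι] {A : Matrix ι ι ℝ}
    (hA : A.IsHermitian) : ∃ (U : Matrix ι ι ℝ) (l : ι → ℝ), Uᵀ * U = 1 ∧ U * Uᵀ = 1 ∧
      A = U * diagonal l * Uᵀ ∧ (A.PosSemidef → ∀ i, 0 ≤ l i) := by
  refine ⟨hA.eigenvectorUnitary, hA.eigenvalues, ?_, ?_, ?_, fun h i => h.eigenvalues_nonneg i⟩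
  · have := Unitary.coe_star_mul_self hA.eigenvectorUnitary
    rwa [star_eq_conjTranspose, conjTranspose_eq_transpose_of_trivial] at this
  · have := Unitary.coe_mul_star_self hA.eigenvectorUnitary
    rwa [Unitary.coe_star, star_eq_conjTranspose, conjTranspose_eq_transpose_of_trivial] at this
  · have := hA.spectral_theorem
    rw [Unitary.conjStarAlgAut_apply, star_eq_conjTranspose,
      conjTranspose_eq_transpose_of_trivial] at this
    exact this

theorem PosSemidef.transpose_mul_mul_same {κ : Type*} [Fintype κ] {A : Matrix ι ι ℝ}
    (hA : A.PosSemidef) (V : Matrix ι κ ℝ) : (Vᵀ * A * V).PosSemidef := by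
  simpa using hA.conjTranspose_mul_mul_same V

theorem PosSemidef.exists_transpose_mul_self [DecidableEq ι] {A : Matrix ι ι ℝ}
    (hA : A.PosSemidef) : ∃ C : Matrix ι ι ℝ, A = Cᵀ * C := by
  obtain ⟨U, l, -, -, h, hl⟩ := hA.1.exists_orthogonal_diagonal
  refine ⟨diagonal (fun i => √(l i)) * Uᵀ, ?_⟩
  have h1 : diagonal l = (diagonal fun i => √(l i)) * diagonal fun i => √(l i) := by
    rw [diagonal_mul_diagonal]
    exact congrArg diagonal (funext fun i => (Real.mul_self_sqrt (hl hA i)).symm)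
  rw [h, transpose_mul, transpose_transpose, diagonal_transpose, h1]
  simp only [mul_assoc]

theorem trace_transpose_mul_self (C : Matrix ι ι ℝ) : (Cᵀ * C).trace = ∑ i, ∑ j, C i j ^ 2 := by
  rw [Finset.sum_comm]
  simp [trace, mul_apply, sq]

theorem trace_transpose_mul_self_mul (C R : Matrix ι ι ℝ) :
    (Cᵀ * C * (R * Rᵀ)).trace = ∑ i, ∑ j, (C * R) i j ^ 2 := by
  rw [← trace_transpose_mul_self, transpose_mul, ← mul_assoc, trace_mul_comm]
  simp only [mul_assoc]

theorem PosSemidef.trace_mul_nonneg [DecidableEq ι] {A B : Matrix ι ι ℝ} (hA : A.PosSemidef)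
    (hB : B.PosSemidef) : 0 ≤ (A * B).trace := by
  obtain ⟨C, rfl⟩ := hA.exists_transpose_mul_self
  obtain ⟨R, rfl⟩ := hB.exists_transpose_mul_self
  have := trace_transpose_mul_self_mul C Rᵀ
  rw [transpose_transpose] at this
  rw [this]
  positivity

theorem sum_sq_mul_le (C R : Matrix ι ι ℝ) :
    ∑ i, ∑ j, (C * R) i j ^ 2 ≤ (∑ i, ∑ j, C i j ^ 2) * ∑ i, ∑ j, R i j ^ 2 := by
  rw [Finset.sum_comm (f := fun i j => R i j ^ 2), Finset.sum_mul_sum]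
  refine Finset.sum_le_sum fun i _ => Finset.sum_le_sum fun j _ => ?_
  exact Finset.sum_mul_sq_le_sq_mul_sq _ _ _

theorem PosSemidef.one_add_mul_trace_le_det [DecidableEq ι] {A : Matrix ι ι ℝ} (hA : A.PosSemidef)
    {s : ℝ} (hs : 0 ≤ s) : 1 + s * A.trace ≤ (1 + s • A).det := by
  obtain ⟨U, l, h1, h2, h, hl⟩ := hA.1.exists_orthogonal_diagonal
  have hl := hl hA
  have h3 : 1 + s • A = U * diagonal (fun i => 1 + s * l i) * Uᵀ := by
    have : (diagonal fun i => 1 + s * l i) = (1 : Matrix ι ι ℝ) + s • diagonal l := by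
      rw [← diagonal_one, ← diagonal_smul, diagonal_add]; rfl
    rw [this, mul_add, add_mul, mul_one, h2, h]
    simp
  have h4 : A.trace = ∑ i, l i := by
    rw [h, trace_mul_comm, ← mul_assoc, h1, one_mul, trace_diagonal]
  have h5 : U.det * Uᵀ.det = 1 := by rw [← det_mul, h2, det_one]
  rw [h3, h4, det_mul, det_mul, mul_right_comm, h5, one_mul, det_diagonal, Finset.mul_sum]
  have h6 : ∀ t : Finset ι, 1 + ∑ i ∈ t, s * l i ≤ ∏ i ∈ t, (1 + s * l i) := by
    intro t
    induction t using Finset.induction_on with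
    | empty => simp
    | insert a t ha ih =>
      rw [Finset.sum_insert ha, Finset.prod_insert ha]
      have h7 : 0 ≤ s * l a := mul_nonneg hs (hl a)
      have h8 : 0 ≤ ∑ i ∈ t, s * l i := Finset.sum_nonneg fun i _ => mul_nonneg hs (hl i)
      nlinarith [mul_le_mul_of_nonneg_left ih (by linarith : (0 : ℝ) ≤ 1 + s * l a),
        mul_nonneg h7 h8]
  exact h6 _

end Matrix

/-! ### Normalization of psd factorizations -/

open Matrix in
/-- Compressing a psd factorization to the support of a weighted average of the left factors turns
this average into the identity. -/
theorem exists_compressed_factorization {I J : Type*} [Fintype I] {r : ℕ}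
    {A : I → Matrix (Fin r) (Fin r) ℝ} {B : J → Matrix (Fin r) (Fin r) ℝ}
    (hA : ∀ i, (A i).PosSemidef) (hB : ∀ j, (B j).PosSemidef) {w : I → ℝ} (hw : ∀ i, 0 < w i) :
    ∃ (ι : Type) (_ : Fintype ι) (_ : DecidableEq ι) (A' : I → Matrix ι ι ℝ)
      (B' : J → Matrix ι ι ℝ), Fintype.card ι ≤ r ∧ (∀ i, (A' i).PosSemidef) ∧
      (∀ j, (B' j).PosSemidef) ∧ (∀ i j, (A i * B j).trace = (A' i * B' j).trace) ∧
      ∑ i, w i • A' i = 1 := by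
  classical
  have hN : (∑ i, w i • A i).PosSemidef :=
    posSemidef_sum _ fun i _ => (hA i).smul (hw i).le
  obtain ⟨U, l, h1, h2, h, hl⟩ := hN.1.exists_orthogonal_diagonal
  have hl := hl hN
  have hd : Uᵀ * (∑ i, w i • A i) * U = diagonal l := by
    rw [h]
    calc _ = (Uᵀ * U) * diagonal l * (Uᵀ * U) := by simp only [Matrix.mul_assoc]
      _ = _ := by rw [h1, one_mul, mul_one]
  -- `E` drops the null eigenvectors and rescales the others by `l ^ (-1/2)`; `E'` undoes the
  -- scaling, so that `E * E'` projects onto the support.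
  let E : Matrix (Fin r) {j // l j ≠ 0} ℝ := of fun a j => if a = j.1 then (√(l j))⁻¹ else 0
  let E' : Matrix {j // l j ≠ 0} (Fin r) ℝ := of fun j a => if a = j.1 then √(l j) else 0
  have hEE : E * E' = diagonal fun a => if l a ≠ 0 then 1 else 0 := by
    ext a b
    simp only [mul_apply, E, E', of_apply, diagonal_apply, ite_mul, zero_mul, mul_ite, mul_zero]
    by_cases ha : l a = 0
    · have h0 : ∀ x : {j // l j ≠ 0}, a ≠ x.1 := fun x hx => x.2 (hx ▸ ha)
      simp [h0, ha]
    · rw [Finset.sum_eq_single (⟨a, ha⟩ : {j // l j ≠ 0})]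
      · have : √(l a) ≠ 0 := (Real.sqrt_pos.mpr (lt_of_le_of_ne (hl a) (Ne.symm ha))).ne'
        by_cases hab : a = b
        · subst hab; simp [ha, this]
        · simp [hab, Ne.symm hab]
      · intro x _ hx
        have : a ≠ x.1 := fun h => hx (Subtype.ext h.symm)
        simp [this]
      · simp
  have hEd : Eᵀ * diagonal l * E = 1 := by
    ext i j
    rw [mul_apply]
    simp only [mul_diagonal, transpose_apply, E, of_apply, mul_ite, mul_zero]
    rw [Finset.sum_ite_eq' Finset.univ j.1, if_pos (Finset.mem_univ _)]
    have hp : 0 < l j := lt_of_le_of_ne (hl j) (Ne.symm j.2)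
    by_cases hij : i = j
    · subst hij
      have : √(l i) ≠ 0 := (Real.sqrt_pos.mpr hp).ne'
      rw [one_apply_eq, if_pos rfl]
      field_simp
      rw [Real.sq_sqrt hp.le]
    · have : j.1 ≠ i.1 := fun h => hij (Subtype.ext h.symm)
      simp [hij, this]
  have hAU : ∀ i, A i * (U * (E * E') * Uᵀ) = A i := by
    intro i
    obtain ⟨C, hC⟩ := (hA i).exists_transpose_mul_self
    -- A null vector of the weighted sum is a null vector of every `A i`, because the terms are
    -- nonnegative and the weights positive.
    have h3 : ∀ a, l a = 0 → ∀ b, (C * U) b a = 0 := by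
      intro a ha
      have h4 : ∑ i, w i * (Uᵀ * A i * U) a a = 0 := by
        have := congrFun (congrFun hd a) a
        rw [diagonal_apply_eq, ha] at this
        rw [← this, Matrix.mul_sum, Matrix.sum_mul, Matrix.sum_apply]
        simp
      have h5 := (Finset.sum_eq_zero_iff_of_nonneg fun i _ =>
        mul_nonneg (hw i).le ((hA i).transpose_mul_mul_same U).diag_nonneg).mp h4 i
          (Finset.mem_univ i)
      have h6 : (Uᵀ * A i * U) a a = ∑ b, (C * U) b a ^ 2 := by
        have : Uᵀ * A i * U = (C * U)ᵀ * (C * U) := by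
          rw [hC, transpose_mul]; simp only [Matrix.mul_assoc]
        rw [this, mul_apply]
        simp [sq]
      rw [h6] at h5
      have h7 := (mul_eq_zero.mp h5).resolve_left (hw i).ne'
      intro b
      have := (Finset.sum_eq_zero_iff_of_nonneg fun b _ => sq_nonneg _).mp h7 b (Finset.mem_univ b)
      exact pow_eq_zero_iff two_ne_zero |>.mp this
    have h8 : C * U * (E * E') = C * U := by
      rw [hEE]
      ext b a
      rw [mul_diagonal]
      by_cases ha : l a = 0
      · simp [h3 a ha b]
      · simp [ha]
    calc A i * (U * (E * E') * Uᵀ) = Cᵀ * (C * U * (E * E')) * Uᵀ := by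
          rw [hC]; simp only [Matrix.mul_assoc]
      _ = A i := by rw [h8, hC, ← mul_assoc, mul_assoc _ U, h2, mul_one]
  have hAU' : ∀ i, (U * (E * E') * Uᵀ)ᵀ * A i = A i := by
    intro i
    have h9 := congrArg transpose (hAU i)
    have h10 : (A i)ᵀ = A i := by simpa using (hA i).1.eq
    rwa [transpose_mul, h10] at h9
  refine ⟨{j // l j ≠ 0}, inferInstance, inferInstance, fun i => (U * E)ᵀ * A i * (U * E),
    fun j => (E' * Uᵀ) * B j * (E' * Uᵀ)ᵀ, ?_, fun i => (hA i).transpose_mul_mul_same _,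
    fun j => ?_, fun i j => ?_, ?_⟩
  · exact (Fintype.card_subtype_le fun j => l j ≠ 0).trans_eq (Fintype.card_fin r)
  · simpa using (hB j).transpose_mul_mul_same (E' * Uᵀ)ᵀ
  · calc (A i * B j).trace
        = ((U * (E * E') * Uᵀ)ᵀ * (A i * (U * (E * E') * Uᵀ)) * B j).trace := by
          rw [hAU, hAU']
      _ = ((E' * Uᵀ)ᵀ * ((U * E)ᵀ * A i * (U * E) * ((E' * Uᵀ) * B j))).trace := by
          congr 1
          simp only [transpose_mul, transpose_transpose, Matrix.mul_assoc]
      _ = _ := by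
          rw [trace_mul_comm]; simp only [Matrix.mul_assoc]
  · calc ∑ i, w i • ((U * E)ᵀ * A i * (U * E))
        = (U * E)ᵀ * (∑ i, w i • A i) * (U * E) := by
          rw [Matrix.mul_sum, Matrix.sum_mul]; simp
      _ = Eᵀ * (Uᵀ * (∑ i, w i • A i) * U) * E := by
          simp only [transpose_mul, Matrix.mul_assoc]
      _ = 1 := by rw [hd, hEd]

open Matrix in
/-- The trace bound at a maximizer of the determinant. -/
theorem trace_le_of_det_le {ι : Type*} [Fintype ι] [DecidableEq ι] {Y : Matrix ι ι ℝ}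
    (hY : Y.PosSemidef)
    (h : ∀ t : ℝ, 0 < t → t < 1 → ((1 - t) • (1 : Matrix ι ι ℝ) + t • Y).det ≤ 1) :
    Y.trace ≤ 2 * Fintype.card ι := by
  rcases Nat.eq_zero_or_pos (Fintype.card ι) with h0 | h0
  · have := Fintype.card_eq_zero_iff.mp h0
    simp
  have hr : (1 : ℝ) ≤ Fintype.card ι := by exact_mod_cast h0
  set r := Fintype.card ι with hrdef
  -- Letting `t → 0` would give the trace bound `r`. This fixed `t` avoids differentiation and costs
  -- a factor `2`: Bernoulli gives `(1 - t) ^ r ≥ 1/2`.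
  set t : ℝ := 1 / (2 * r) with ht
  have ht0 : 0 < t := by positivity
  have htr : t * r = 1 / 2 := by rw [ht]; field_simp
  have ht1 : t ≤ 1 / 2 := by nlinarith
  have h1 := h t ht0 (by linarith)
  have h2 : (1 - t) • (1 : Matrix ι ι ℝ) + t • Y = (1 - t) • (1 + (t / (1 - t)) • Y) := by
    rw [smul_add, smul_smul, mul_div_cancel₀]
    linarith
  rw [h2, det_smul, ← hrdef] at h1
  have hs : 0 < t / (1 - t) := div_pos ht0 (by linarith)
  have h3 := hY.one_add_mul_trace_le_det hs.le
  have h4 : 1 / 2 ≤ (1 - t) ^ r := by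
    have := one_add_mul_le_pow (a := -t) (by linarith) r
    rw [← sub_eq_add_neg] at this
    linarith
  have h5 : 0 ≤ Y.trace := hY.trace_nonneg
  have h6 : 1 / 2 * (1 + t / (1 - t) * Y.trace) ≤ 1 := by
    refine le_trans ?_ h1
    have : 0 ≤ 1 + t / (1 - t) * Y.trace := by positivity
    nlinarith [mul_le_mul h4 h3 this (by linarith)]
  have h7 : t ≤ t / (1 - t) := by
    rw [le_div_iff₀ (by linarith)]; nlinarith
  have h8 : t * Y.trace ≤ 1 := by nlinarith
  have h9 : Y.trace = 2 * r * (t * Y.trace) := by rw [ht]; field_simp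
  rw [h9]
  nlinarith

-- After compression the uniform average of the left factors is `1`. Maximize `det (1 + ∑ ν i • A
-- i)` over the simplex and conjugate so that the maximizing matrix becomes `1`. The uniform average
-- `E` of the new factors is then at most `1`, optimality bounds every single trace, and `1` is a
-- positive combination of the factors, which turns `Tr (B j)` into an average of column `j` of `M`.
open Matrix in
theorem exists_normalized_factorization {I J : Type*} [Fintype I] [Nonempty I]
    {M : Matrix I J ℝ} {r : ℕ} (h : HasPsdFactorization M r) :
    ∃ (ι : Type) (_ : Fintype ι) (_ : DecidableEq ι) (A : I → Matrix ι ι ℝ)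
      (B : J → Matrix ι ι ℝ) (w : I → ℝ), Fintype.card ι ≤ r ∧ (∀ i, (A i).PosSemidef) ∧
      (∀ j, (B j).PosSemidef) ∧ (∀ i j, M i j = (A i * B j).trace) ∧
      (∀ P : Matrix ι ι ℝ, P.PosSemidef → 𝔼 i, (A i * P).trace ≤ 2 * P.trace) ∧
      (∀ i, (A i).trace ≤ 4 * Fintype.card ι) ∧ (∀ i, 0 ≤ w i) ∧ ∑ i, w i = 1 ∧
      ∀ j, (B j).trace = ∑ i, w i * M i j := by
  classical
  obtain ⟨A₀, B₀, hA₀, hB₀, hM⟩ := h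
  have hcard : (0 : ℝ) < Fintype.card I := by exact_mod_cast Fintype.card_pos
  obtain ⟨ι, _, _, A, B, hr, hA, hB, hAB, h1⟩ := exists_compressed_factorization hA₀ hB₀
    (w := fun _ => (Fintype.card I : ℝ)⁻¹) fun _ => inv_pos.mpr hcard
  let G : (I → ℝ) → Matrix ι ι ℝ := fun ν => 1 + ∑ i, ν i • A i
  have hGc : Continuous fun ν => (G ν).det := by
    refine Continuous.matrix_det ?_
    exact continuous_const.add (continuous_finsetSum _ fun i _ =>
      (continuous_apply i).smul continuous_const)
  obtain ⟨ν, hν, hmax⟩ := (isCompact_stdSimplex ℝ I).exists_isMaxOn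
    ⟨_, single_mem_stdSimplex ℝ (Classical.arbitrary I)⟩ hGc.continuousOn
  have hFpsd : (∑ i, ν i • A i).PosSemidef :=
    posSemidef_sum _ fun i _ => (hA i).smul (hν.1 i)
  have hGpd : (G ν).PosDef := PosDef.one.add_posSemidef hFpsd
  obtain ⟨C, hC⟩ := hGpd.posSemidef.exists_transpose_mul_self
  have hdet : C.det ≠ 0 := by
    intro h0
    have := hGpd.det_pos
    rw [hC, det_mul, h0, mul_zero] at this
    exact lt_irrefl _ this
  have hu : IsUnit C.det := isUnit_iff_ne_zero.mpr hdet
  have hCC : C * C⁻¹ = 1 := mul_nonsing_inv _ hu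
  have hCC' : C⁻¹ * C = 1 := nonsing_inv_mul _ hu
  have hCCT : (C⁻¹)ᵀ * Cᵀ = 1 := by rw [← transpose_mul, hCC, transpose_one]
  let E : Matrix ι ι ℝ := (C⁻¹)ᵀ * C⁻¹
  let X : I → Matrix ι ι ℝ := fun i => (C⁻¹)ᵀ * A i * C⁻¹
  have hconj : ∀ ν', (C⁻¹)ᵀ * G ν' * C⁻¹ = E + ∑ i, ν' i • X i := by
    intro ν'
    simp only [G, E, X, mul_add, add_mul, mul_one, Matrix.mul_sum, Matrix.sum_mul,
      Matrix.mul_smul, Matrix.smul_mul]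
  have hEF : E + ∑ i, ν i • X i = 1 := by
    rw [← hconj, hC, ← mul_assoc, hCCT, one_mul, hCC]
  have hE : E.PosSemidef := by simpa using (PosSemidef.one (n := ι) (R := ℝ)).transpose_mul_mul_same C⁻¹
  have hX : ∀ i, (X i).PosSemidef := fun i => (hA i).transpose_mul_mul_same _
  have hF : (∑ i, ν i • X i).PosSemidef := posSemidef_sum _ fun i _ => (hX i).smul (hν.1 i)
  have hEavg : ∑ i, (Fintype.card I : ℝ)⁻¹ • X i = E := by
    calc _ = (C⁻¹)ᵀ * (∑ i, (Fintype.card I : ℝ)⁻¹ • A i) * C⁻¹ := by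
          rw [Matrix.mul_sum, Matrix.sum_mul]; simp [X]
      _ = E := by rw [h1, mul_one]
  have hdetle : ∀ ν' ∈ stdSimplex ℝ I, (E + ∑ i, ν' i • X i).det ≤ 1 := by
    intro ν' hν'
    have h2 : (G ν').det ≤ (G ν).det := hmax hν'
    rw [← hconj]
    have h3 : ((C⁻¹)ᵀ * G ν * C⁻¹).det = 1 := by rw [hconj, hEF, det_one]
    rw [det_mul, det_mul, det_transpose, mul_right_comm] at h3 ⊢
    have h4 : 0 ≤ C⁻¹.det * C⁻¹.det := mul_self_nonneg _
    nlinarith [mul_le_mul_of_nonneg_left h2 h4]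
  have htrX : ∀ i, (X i).trace ≤ 2 * Fintype.card ι := by
    intro i
    -- Moving from the maximizer a fraction `t` of the way to vertex `i` gives the matrix `(1 - t)·1
    -- + t (E + X i)`.
    have h2 : (E + X i).trace ≤ 2 * Fintype.card ι := by
      refine trace_le_of_det_le (hE.add (hX i)) fun t ht0 ht1 => ?_
      have h3 := hdetle (fun k => (1 - t) * ν k + t * Pi.single (M := fun _ => ℝ) i 1 k) ?_
      · convert h3 using 2
        simp only [add_smul, Finset.sum_add_distrib, mul_smul, ← Finset.smul_sum]
        have h4 : ∑ k, Pi.single (M := fun _ => ℝ) i 1 k • X k = X i := by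
          simp [Pi.single_apply]
        rw [h4, ← hEF]
        module
      · refine ⟨fun k => ?_, ?_⟩
        · have := hν.1 k
          have h5 : 0 ≤ Pi.single (M := fun _ => ℝ) i 1 k := by
            rw [Pi.single_apply]; split_ifs <;> norm_num
          have : 0 ≤ 1 - t := by linarith
          positivity
        · rw [Finset.sum_add_distrib, ← Finset.mul_sum, ← Finset.mul_sum, hν.2]
          simp
    have := hE.trace_nonneg
    rw [trace_add] at h2
    linarith
  have hXB : ∀ i j, ((2 : ℝ) • X i * ((1 / 2 : ℝ) • (C * B j * Cᵀ))).trace = M i j := by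
    intro i j
    rw [hM, hAB, Matrix.smul_mul, Matrix.mul_smul, smul_smul]
    norm_num
    calc (X i * (C * B j * Cᵀ)).trace
        = ((C⁻¹)ᵀ * (A i * (C⁻¹ * C) * B j * Cᵀ)).trace := by simp only [X, Matrix.mul_assoc]
      _ = (A i * B j * (Cᵀ * (C⁻¹)ᵀ)).trace := by
          rw [hCC', mul_one, trace_mul_comm]; simp only [Matrix.mul_assoc]
      _ = (A i * B j).trace := by rw [← transpose_mul, hCC', transpose_one, mul_one]
  -- The weights `1/|I| + ν i` that produce `1` have total mass `2`. Halving them and doubling the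
  -- factors makes them a probability vector.
  refine ⟨ι, inferInstance, inferInstance, fun i => (2 : ℝ) • X i,
    fun j => (1 / 2 : ℝ) • (C * B j * Cᵀ), fun i => ((Fintype.card I : ℝ)⁻¹ + ν i) / 2, hr,
    fun i => (hX i).smul (by norm_num), fun j => PosSemidef.smul ?_ (by norm_num),
    fun i j => (hXB i j).symm, fun P hP => ?_, fun i => ?_, fun i => ?_, ?_, fun j => ?_⟩
  · simpa using (hB j).transpose_mul_mul_same Cᵀ
  · have h2 := hF.trace_mul_nonneg hP
    have h3 : (E * P).trace + ((∑ i, ν i • X i) * P).trace = P.trace := by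
      rw [← trace_add, ← add_mul, hEF, one_mul]
    have h4 : 𝔼 i, ((2 : ℝ) • X i * P).trace = 2 * (E * P).trace := by
      rw [← hEavg, Matrix.sum_mul, trace_sum, Fintype.expect_eq_sum_div_card, Finset.mul_sum,
        Finset.sum_div]
      refine Finset.sum_congr rfl fun i _ => ?_
      simp only [Matrix.smul_mul, trace_smul, smul_eq_mul]
      ring
    rw [h4]
    linarith
  · rw [trace_smul, smul_eq_mul]
    linarith [htrX i]
  · have := hν.1 i
    positivity
  · rw [← Finset.sum_div, Finset.sum_add_distrib, hν.2, Finset.sum_const, Finset.card_univ,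
      nsmul_eq_mul, mul_inv_cancel₀ hcard.ne']
    norm_num
  · have h2 : (1 : Matrix ι ι ℝ) = ∑ i, (((Fintype.card I : ℝ)⁻¹ + ν i) / 2) • ((2 : ℝ) • X i) := by
      rw [← hEF, ← hEavg, ← Finset.sum_add_distrib]
      refine Finset.sum_congr rfl fun i _ => ?_
      module
    calc _ = (1 * ((1 / 2 : ℝ) • (C * B j * Cᵀ))).trace := by rw [one_mul]
      _ = _ := by
        rw [h2, Matrix.sum_mul, trace_sum]
        refine Finset.sum_congr rfl fun i _ => ?_
        rw [← hXB i j]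
        simp only [Matrix.smul_mul, trace_smul, smul_eq_mul]

/-! ### Traces of powers -/

/-- The convex function `v ^ (j + 1)` lies above its tangent at `c`. -/
theorem pow_add_mul_sub_le_pow {v c : ℝ} (hv : 0 ≤ v) (hc : 0 ≤ c) (j : ℕ) :
    c ^ (j + 1) + (j + 1) * c ^ j * (v - c) ≤ v ^ (j + 1) := by
  rcases hc.eq_or_lt with rfl | hc
  · rcases Nat.eq_zero_or_pos j with rfl | hj
    · simp
    · simp only [ne_eq, Nat.succ_ne_zero, not_false_eq_true, zero_pow, hj.ne', mul_zero, zero_mul,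
        add_zero]
      positivity
  · have h1 := one_add_mul_sub_le_pow (a := v / c)
      (by have : 0 ≤ v / c := by positivity
          linarith) (j + 1)
    have h2 := mul_le_mul_of_nonneg_left h1 (pow_pos hc (j + 1)).le
    have h3 : c ^ (j + 1) * (v / c) ^ (j + 1) = v ^ (j + 1) := by
      rw [← mul_pow, mul_div_cancel₀ _ hc.ne']
    rw [h3] at h2
    refine le_trans (le_of_eq ?_) h2
    push_cast
    field_simp
    ring

namespace Matrix

theorem posSemidef_of_trace_mul_nonneg {ι : Type*} [Fintype ι] {H : Matrix ι ι ℝ} (hH : H.IsHermitian)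
    (h : ∀ P : Matrix ι ι ℝ, P.PosSemidef → 0 ≤ (H * P).trace) : H.PosSemidef := by
  refine .of_dotProduct_mulVec_nonneg hH fun u => ?_
  have h1 := h _ (posSemidef_vecMulVec_self_star u)
  rw [mul_vecMulVec, trace_vecMulVec, dotProduct_comm] at h1
  exact h1

theorem IsHermitian.transpose_eq {ι : Type*} {H : Matrix ι ι ℝ} (hH : H.IsHermitian) : Hᵀ = H := by
  simpa using hH.eq

variable {ι : Type*} [Fintype ι] [DecidableEq ι]

theorem pow_orthogonal_diagonal {V U : Matrix ι ι ℝ} {l : ι → ℝ} (h1 : Uᵀ * U = 1)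
    (h2 : U * Uᵀ = 1) (hV : V = U * diagonal l * Uᵀ) (j : ℕ) :
    V ^ j = U * diagonal (fun i => l i ^ j) * Uᵀ := by
  induction j with
  | zero => simp [h2]
  | succ j ih =>
    rw [pow_succ, ih]
    nth_rewrite 1 [hV]
    calc _ = U * diagonal (fun i => l i ^ j) * (Uᵀ * U) * diagonal l * Uᵀ := by
          simp only [mul_assoc]
      _ = U * (diagonal (fun i => l i ^ j) * diagonal l) * Uᵀ := by
          rw [h1, mul_one]; simp only [mul_assoc]
      _ = _ := by rw [diagonal_mul_diagonal]; simp only [pow_succ]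

theorem trace_mul_orthogonal_diagonal (B U : Matrix ι ι ℝ) (l : ι → ℝ) :
    (B * (U * diagonal l * Uᵀ)).trace = ∑ i, (Uᵀ * B * U) i i * l i := by
  have : (B * (U * diagonal l * Uᵀ)).trace = (Uᵀ * B * U * diagonal l).trace := by
    rw [← mul_assoc, trace_mul_comm]; simp only [mul_assoc]
  rw [this]
  simp [trace]

/-- In an eigenbasis of `V` the diagonal of `B` consists of weights in `[0, 1]`; apply the tangent
at `c` to each eigenvalue. -/
theorem PosSemidef.le_trace_pow {V B : Matrix ι ι ℝ} (hV : V.PosSemidef) (hB : B.PosSemidef)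
    (hB1 : B.trace ≤ 1) {c : ℝ} (hc : 0 ≤ c) (j : ℕ) :
    c ^ (j + 1) * B.trace + (j + 1) * c ^ j * ((B * V).trace - c * B.trace) ≤
      (V ^ (j + 1)).trace := by
  obtain ⟨U, l, h1, h2, h, hl⟩ := hV.1.exists_orthogonal_diagonal
  have hl := hl hV
  have htr : B.trace = ∑ i, (Uᵀ * B * U) i i := by
    have := trace_mul_orthogonal_diagonal B U 1
    simpa [h2] using this
  have hBV : (B * V).trace = ∑ i, (Uᵀ * B * U) i i * l i := by
    nth_rewrite 1 [h]
    exact trace_mul_orthogonal_diagonal B U l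
  have hVj : (V ^ (j + 1)).trace = ∑ i, l i ^ (j + 1) := by
    rw [pow_orthogonal_diagonal h1 h2 h, trace_mul_comm, ← mul_assoc, h1, one_mul, trace_diagonal]
  have hp0 : ∀ i, 0 ≤ (Uᵀ * B * U) i i := fun i => (hB.transpose_mul_mul_same U).diag_nonneg
  have hp1 : ∀ i, (Uᵀ * B * U) i i ≤ 1 := fun i =>
    (Finset.single_le_sum (fun i _ => hp0 i) (Finset.mem_univ i)).trans (htr ▸ hB1)
  rw [hBV, hVj, htr, Finset.mul_sum, Finset.mul_sum, ← Finset.sum_sub_distrib, Finset.mul_sum,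
    ← Finset.sum_add_distrib]
  refine Finset.sum_le_sum fun i _ => ?_
  calc _ = (Uᵀ * B * U) i i * (c ^ (j + 1) + (j + 1) * c ^ j * (l i - c)) := by ring
    _ ≤ (Uᵀ * B * U) i i * l i ^ (j + 1) :=
        mul_le_mul_of_nonneg_left (pow_add_mul_sub_le_pow (hl i) hc j) (hp0 i)
    _ ≤ 1 * l i ^ (j + 1) := mul_le_mul_of_nonneg_right (hp1 i) (pow_nonneg (hl i) _)
    _ = _ := one_mul _

/-- Here the tangent is taken at each eigenvalue of `V` and evaluated at `θ`. -/
theorem PosSemidef.mul_trace_pow_le {V : Matrix ι ι ℝ} (hV : V.PosSemidef) {θ : ℝ} (hθ : 0 ≤ θ)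
    (j : ℕ) : (j + 1) * θ * (V ^ j).trace ≤
      j * (V ^ (j + 1)).trace + Fintype.card ι * θ ^ (j + 1) := by
  obtain ⟨U, l, h1, h2, h, hl⟩ := hV.1.exists_orthogonal_diagonal
  have hl := hl hV
  have hVj : ∀ j, (V ^ j).trace = ∑ i, l i ^ j := by
    intro j
    rw [pow_orthogonal_diagonal h1 h2 h, trace_mul_comm, ← mul_assoc, h1, one_mul, trace_diagonal]
  have h3 : (Fintype.card ι : ℝ) * θ ^ (j + 1) = ∑ _i : ι, θ ^ (j + 1) := by
    rw [Finset.sum_const, nsmul_eq_mul]; rfl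
  rw [hVj, hVj, h3, Finset.mul_sum, Finset.mul_sum, ← Finset.sum_add_distrib]
  refine Finset.sum_le_sum fun i _ => ?_
  have := pow_add_mul_sub_le_pow hθ (hl i) j
  have h4 : l i ^ (j + 1) = l i ^ j * l i := pow_succ _ _
  rw [h4] at this ⊢
  linarith

end Matrix

/-- If `V` correlates with a bounded density `B`, then the average of `V` with respect to the
weight `V ^ (2 k)` is large. -/
theorem mul_expect_trace_pow_le {X ι : Type*} [Fintype X] [Nonempty X] [Fintype ι] [DecidableEq ι]
    {V B : X → Matrix ι ι ℝ} (hV : ∀ x, (V x).PosSemidef) (hB : ∀ x, (B x).PosSemidef)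
    (hB1 : ∀ x, (B x).trace ≤ 1) {μ c θ : ℝ} (hμ : 𝔼 x, (B x).trace = μ) (hμ0 : 0 < μ)
    (hc : 0 < c) (hθ : 0 ≤ θ) (hBV : c * μ ≤ 𝔼 x, (B x * V x).trace) (k : ℕ)
    (hk : Fintype.card ι * θ ^ (2 * k + 1) ≤ μ * c ^ (2 * k + 1)) :
    0 < 𝔼 x, (V x ^ (2 * k)).trace ∧
      θ * 𝔼 x, (V x ^ (2 * k)).trace ≤ 𝔼 x, (V x ^ (2 * k + 1)).trace := by
  have h1 := Finset.expect_le_expect (s := Finset.univ) fun x _ =>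
    (hV x).le_trace_pow (hB x) (hB1 x) hc.le (2 * k)
  have h2 := Finset.expect_le_expect (s := Finset.univ) fun x _ =>
    (hV x).mul_trace_pow_le hθ (2 * k)
  simp only [Finset.expect_add_distrib, ← Finset.mul_expect, Finset.expect_sub_distrib, hμ] at h1
  simp only [Finset.expect_add_distrib, ← Finset.mul_expect,
    Finset.expect_const Finset.univ_nonempty] at h2
  have h3 : μ * c ^ (2 * k + 1) ≤ 𝔼 x, (V x ^ (2 * k + 1)).trace := by
    have : 0 ≤ ((2 * k : ℕ) + 1 : ℝ) * c ^ (2 * k) * ((𝔼 x, (B x * V x).trace) - c * μ) :=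
      mul_nonneg (by positivity) (by linarith)
    linarith
  have hpsd : ∀ x, (V x ^ (2 * k)).PosSemidef := fun x => (hV x).pow _
  constructor
  · refine lt_of_le_of_ne (Finset.expect_nonneg fun x _ => (hpsd x).trace_nonneg) fun h0 => ?_
    have h4 : ∀ x, V x ^ (2 * k) = 0 := by
      intro x
      have h5 := (Finset.expect_eq_zero_iff_of_nonneg
        fun x _ => (hpsd x).trace_nonneg).mp h0.symm
      exact (hpsd x).trace_eq_zero_iff.mp (h5 x (Finset.mem_univ x))
    have h5 : 0 < μ * c ^ (2 * k + 1) := by positivity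
    simp only [pow_succ, h4, zero_mul, Matrix.trace_zero, Finset.expect_const_zero] at h3 h5
    linarith
  -- By `hk` and `h3` the error `card ι * θ ^ (2k + 1)` in `h2` is at most one further copy of `𝔼 Tr
  -- V ^ (2k + 1)`.
  · have h6 : (0 : ℝ) < (2 * k : ℕ) + 1 := by positivity
    refine le_of_mul_le_mul_left ?_ h6
    nlinarith

/-- The part of `C_S R` of high degree in the variables of a random `S` is small. -/
theorem expect_highPart_mul_le {ι : Type*} [Fintype ι] {n m K : ℕ} (k : ℕ) (hmn : m ≤ n)
    (hn : 0 < n) {R : Cube n → Matrix ι ι ℝ} (hR : ∀ i j, CubeDegreeLE K fun x => R x i j)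
    {C : SubsetOfCard n m → Matrix ι ι ℝ} {a : ℝ} (ha : 0 ≤ a)
    (hC : ∀ S, ∑ i, ∑ j, C S i j ^ 2 ≤ a) :
    𝔼 S : SubsetOfCard n m, ∑ i, ∑ j, 𝔼 x, highPart k S.1 (fun x => (C S * R x) i j) x ^ 2 ≤
      a * ((K : ℝ) * m / n) ^ (k + 1) * 𝔼 x, ∑ i, ∑ j, R x i j ^ 2 := by
  let F : Finset (Fin n) → Matrix ι ι ℝ := fun T => .of fun i j => cubeFourier (fun x => R x i j) T
  have hF : ∀ S T i j, cubeFourier (fun x => (C S * R x) i j) T = (C S * F T) i j := by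
    intro S T i j
    simp only [Matrix.mul_apply, cubeFourier_sum, cubeFourier_const_mul, F, Matrix.of_apply]
  have hpars : 𝔼 x, ∑ i, ∑ j, R x i j ^ 2 = ∑ T, ∑ i, ∑ j, F T i j ^ 2 := by
    rw [← Finset.sum_comm_cycle, Finset.expect_sum_comm]
    refine Finset.sum_congr rfl fun i _ => ?_
    rw [Finset.expect_sum_comm]
    exact Finset.sum_congr rfl fun j _ => expect_sq_eq_sum_cubeFourier_sq _
  -- Bounding `C S * F T` in Frobenius norm for each `T` leaves `S` only in the indicator, whose
  -- average is the intersection probability.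
  have h1 : ∀ S : SubsetOfCard n m,
      ∑ i, ∑ j, 𝔼 x, highPart k S.1 (fun x => (C S * R x) i j) x ^ 2 ≤
      ∑ T, (a * ∑ i, ∑ j, F T i j ^ 2) * if k < #(T ∩ S.1) then (1 : ℝ) else 0 := by
    intro S
    simp only [expect_highPart_sq, hF]
    calc _ = ∑ T, ∑ i, ∑ j, if k < #(T ∩ S.1) then (C S * F T) i j ^ 2 else 0 := by
          rw [Finset.sum_comm_cycle]
      _ ≤ _ := by
          refine Finset.sum_le_sum fun T _ => ?_
          split_ifs
          · rw [mul_one]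
            exact (Matrix.sum_sq_mul_le _ _).trans
              (mul_le_mul_of_nonneg_right (hC S) (by positivity))
          · simp
  refine (Finset.expect_le_expect fun S _ => h1 S).trans ?_
  rw [Finset.expect_sum_comm, hpars, Finset.mul_sum]
  refine Finset.sum_le_sum fun T _ => ?_
  rw [← Finset.mul_expect, mul_right_comm a (_ ^ _)]
  rcases le_or_gt #T K with hT | hT
  · exact mul_le_mul_of_nonneg_left (expect_card_inter_gt_le k hmn hn hT) (by positivity)
  · have : ∀ i j, F T i j = 0 := fun i j => hR i j T hT
    simp [this]

/-! ### The main inequality -/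

theorem CubeDegreeLE.matrix_pow {n m : ℕ} {ι : Type*} [Fintype ι] [DecidableEq ι]
    {V : Cube n → Matrix ι ι ℝ} (hV : ∀ i j, CubeDegreeLE m fun x => V x i j) (k : ℕ) (i j : ι) :
    CubeDegreeLE (k * m) fun x => (V x ^ k) i j := by
  induction k generalizing i j with
  | zero =>
    simp only [pow_zero]
    exact CubeDegreeLE.const _
  | succ k ih =>
    simp only [pow_succ, Matrix.mul_apply, Nat.succ_mul]
    exact CubeDegreeLE.sum fun l _ => (ih i l).mul (hV l j)

open Matrix in
/-- A pseudo-density for each `S` bounds the average against low-degree squares from below. -/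
theorem IsPseudoDensity.expect_expect_trace_ge {n m d K : ℕ} (hmn : m ≤ n) (hn : 0 < n)
    {D : Cube m → ℝ} (hD : IsPseudoDensity d D) {Δ : ℝ} (hΔ : ∀ y, |D y| ≤ Δ) (hΔ0 : 0 ≤ Δ)
    {ι : Type*} [Fintype ι] [DecidableEq ι] {A : SubsetOfCard n m → Matrix ι ι ℝ}
    (hA : ∀ S, (A S).PosSemidef) {a : ℝ} (ha : 0 ≤ a) (hAa : ∀ S, (A S).trace ≤ a)
    {b : ℝ} (hAb : ∀ P : Matrix ι ι ℝ, P.PosSemidef → 𝔼 S, (A S * P).trace ≤ b * P.trace)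
    {R : Cube n → Matrix ι ι ℝ} (hR : ∀ i j, CubeDegreeLE K fun x => R x i j)
    {η : ℝ} (hη : 0 < η) :
    -(Δ * (η * b + (1 + 1 / η) * (a * ((K : ℝ) * m / n) ^ (d / 2 + 1))) *
        𝔼 x, (R x * (R x)ᵀ).trace) ≤
      𝔼 x, 𝔼 S, D (cubeRestrict S x) * (A S * (R x * (R x)ᵀ)).trace := by
  choose C hC using fun S => (hA S).exists_transpose_mul_self
  have hCa : ∀ S, ∑ i, ∑ j, C S i j ^ 2 ≤ a := fun S => by
    rw [← trace_transpose_mul_self, ← hC]; exact hAa S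
  have htr : ∀ S x, (A S * (R x * (R x)ᵀ)).trace = ∑ i, ∑ j, (C S * R x) i j ^ 2 := fun S x => by
    rw [hC S, trace_transpose_mul_self_mul]
  have hRtr : ∀ x, (R x * (R x)ᵀ).trace = ∑ i, ∑ j, R x i j ^ 2 := fun x => by
    have := trace_transpose_mul_self (R x)ᵀ
    rw [transpose_transpose] at this
    rw [this, Finset.sum_comm]
    rfl
  have hpsd : ∀ x, (R x * (R x)ᵀ).PosSemidef := fun x => by
    simpa using posSemidef_self_mul_conjTranspose (R x)
  have h1 : ∀ S, -(Δ * (η * ∑ i, ∑ j, 𝔼 x, (C S * R x) i j ^ 2 + (1 + 1 / η) *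
      ∑ i, ∑ j, 𝔼 x, highPart (d / 2) S.1 (fun x => (C S * R x) i j) x ^ 2)) ≤
      𝔼 x, D (cubeRestrict S x) * ∑ i, ∑ j, (C S * R x) i j ^ 2 := by
    intro S
    simp only [Finset.mul_sum, Finset.expect_sum_comm, ← Finset.sum_add_distrib,
      ← Finset.sum_neg_distrib]
    refine Finset.sum_le_sum fun i _ => Finset.sum_le_sum fun j _ => ?_
    exact hD.expect_restrict_ge hΔ S _ hη
  have h2 := Finset.expect_le_expect (s := Finset.univ) fun S _ => h1 S
  rw [Finset.expect_neg_distrib, ← Finset.mul_expect, Finset.expect_add_distrib,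
    ← Finset.mul_expect, ← Finset.mul_expect] at h2
  have h3 : 𝔼 S, ∑ i, ∑ j, 𝔼 x, (C S * R x) i j ^ 2 ≤ b * 𝔼 x, (R x * (R x)ᵀ).trace := by
    calc _ = 𝔼 x, 𝔼 S, (A S * (R x * (R x)ᵀ)).trace := by
          rw [Finset.expect_comm]
          refine Finset.expect_congr rfl fun S _ => ?_
          simp only [htr, Finset.expect_sum_comm]
      _ ≤ 𝔼 x, b * (R x * (R x)ᵀ).trace :=
          Finset.expect_le_expect fun x _ => hAb _ (hpsd x)
      _ = _ := by rw [← Finset.mul_expect]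
  have h4 := expect_highPart_mul_le (d / 2) hmn hn hR ha hCa
  simp only [← hRtr] at h4
  have h5 : 𝔼 x, 𝔼 S, D (cubeRestrict S x) * (A S * (R x * (R x)ᵀ)).trace =
      𝔼 S, 𝔼 x, D (cubeRestrict S x) * ∑ i, ∑ j, (C S * R x) i j ^ 2 := by
    rw [Finset.expect_comm]
    simp only [htr]
  rw [h5]
  refine le_trans (neg_le_neg ?_) h2
  rw [mul_assoc]
  refine mul_le_mul_of_nonneg_left ?_ hΔ0
  exact (add_le_add (mul_le_mul_of_nonneg_left h3 hη.le)
    (mul_le_mul_of_nonneg_left h4 (by positivity))).trans_eq (by ring)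

-- The average of `W` under the weight `V ^ (2k)` is bounded from above by the power method and from
-- below by the pseudo-density.
open Matrix in
theorem sq_le_of_hasPsdFactorization {n m d r : ℕ} (hmn : m ≤ n) (hn : 0 < n) {f D : Cube m → ℝ}
    (hf : ∀ x, f x ∈ Set.Icc (0 : ℝ) 1) (hD : IsPseudoDensity d D) {Δ ε s : ℝ}
    (hΔ : ∀ y, |D y| ≤ Δ) (hΔ0 : 0 < Δ) (hμ0 : 0 < 𝔼 x, f x) (hs0 : 0 < s) (hs1 : s ≤ 1)
    (hs : s * (Δ * 𝔼 x, f x) = ε) (hDf : 𝔼 x, D x * f x < -ε)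
    (hr : HasPsdFactorization (restrictionMatrix n f) r) (k : ℕ)
    (hk : r * (2 + s / 2) ^ (2 * k + 1) ≤ (𝔼 x, f x) * (2 + s) ^ (2 * k + 1)) :
    s ^ 2 ≤ 144 * r * (((k * m : ℕ) : ℝ) * m / n) ^ (d / 2 + 1) := by
  set μ := 𝔼 x, f x with hμdef
  have : Nonempty (SubsetOfCard n m) := by
    rw [← Fintype.card_pos_iff]
    simpa using Nat.choose_pos hmn
  obtain ⟨ι, _, _, A, B, w, hqr, hA, hB, hM, hA2, hAtr, hw0, hw1, hBtr⟩ :=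
    exists_normalized_factorization hr
  have hqr' : (Fintype.card ι : ℝ) ≤ r := by exact_mod_cast hqr
  have hB1 : ∀ x, (B x).trace ≤ 1 := by
    intro x
    rw [hBtr, ← hw1]
    exact Finset.sum_le_sum fun S _ => mul_le_of_le_one_right (hw0 S) (hf _).2
  have hBμ : 𝔼 x, (B x).trace = μ := by
    simp only [hBtr]
    rw [Finset.expect_sum_comm]
    simp only [← Finset.mul_expect, restrictionMatrix, of_apply, expect_comp_cubeRestrict]
    rw [← Finset.sum_mul, hw1, one_mul]
  let W : Cube n → Matrix ι ι ℝ := fun x => of fun i j => 𝔼 S, D (cubeRestrict S x) * A S i j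
  have hWtr : ∀ x P, (W x * P).trace = 𝔼 S, D (cubeRestrict S x) * (A S * P).trace := by
    intro x P
    simp only [trace, diag_apply, mul_apply, W, of_apply, Finset.expect_mul, Finset.mul_sum]
    rw [Finset.expect_sum_comm]
    refine Finset.sum_congr rfl fun i _ => ?_
    rw [Finset.expect_sum_comm]
    simp only [mul_assoc]
  have hWh : ∀ x, (W x).IsHermitian := by
    intro x
    ext i j
    have : ∀ S, A S j i = A S i j := fun S => congrFun (congrFun (hA S).1.transpose_eq i) j
    simp [W, this]
  let V : Cube n → Matrix ι ι ℝ := fun x => (2 * Δ) • (1 : Matrix ι ι ℝ) - W x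
  have hVtr : ∀ x P, (V x * P).trace = 2 * Δ * P.trace - (W x * P).trace := by
    intro x P
    simp [V, sub_mul]
  -- `W x ≤ Δ 𝔼_S A_S ≤ 2Δ·1`, the last step by the normalization.
  have hVpsd : ∀ x, (V x).PosSemidef := by
    intro x
    refine posSemidef_of_trace_mul_nonneg ?_ fun P hP => ?_
    · refine IsHermitian.sub ?_ (hWh x)
      ext i j
      simp [one_apply, eq_comm]
    · rw [hVtr, hWtr, sub_nonneg]
      calc _ ≤ 𝔼 S, Δ * (A S * P).trace := Finset.expect_le_expect fun S _ =>
            mul_le_mul_of_nonneg_right ((le_abs_self _).trans (hΔ _)) ((hA S).trace_mul_nonneg hP)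
        _ = Δ * 𝔼 S, (A S * P).trace := by rw [Finset.mul_expect]
        _ ≤ Δ * (2 * P.trace) := mul_le_mul_of_nonneg_left (hA2 P hP) hΔ0.le
        _ = _ := by ring
  have hVdeg : ∀ i j, CubeDegreeLE m fun x => V x i j := by
    intro i j
    simp only [V, Matrix.sub_apply, W, of_apply]
    refine (CubeDegreeLE.const _).sub (CubeDegreeLE.expect fun S _ => ?_)
    simp only [mul_comm _ (A S i j)]
    exact ((cubeDegreeLE_self D).comp_cubeRestrict S).const_mul _
  have hWB : 𝔼 x, (W x * B x).trace = 𝔼 y, D y * f y := by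
    simp only [hWtr, ← hM]
    rw [Finset.expect_comm]
    simp only [restrictionMatrix, of_apply]
    have : ∀ S : SubsetOfCard n m, 𝔼 x, D (cubeRestrict S x) * f (cubeRestrict S x) =
      𝔼 y, D y * f y := fun S => expect_comp_cubeRestrict S fun y => D y * f y
    simp only [this]
    exact Finset.expect_const Finset.univ_nonempty _
  have hBV : Δ * (2 + s) * μ ≤ 𝔼 x, (B x * V x).trace := by
    have h1 : ∀ x, (B x * V x).trace = 2 * Δ * (B x).trace - (W x * B x).trace := fun x => by
      rw [trace_mul_comm, hVtr]
    simp only [h1, Finset.expect_sub_distrib, ← Finset.mul_expect, hBμ, hWB]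
    linarith
  have hk' : Fintype.card ι * (Δ * (2 + s / 2)) ^ (2 * k + 1) ≤
      μ * (Δ * (2 + s)) ^ (2 * k + 1) := by
    rw [mul_pow, mul_pow]
    have h1 := mul_le_mul_of_nonneg_right hqr'
      (by positivity : 0 ≤ (2 + s / 2) ^ (2 * k + 1))
    have h2 := mul_le_mul_of_nonneg_left (h1.trans hk) (pow_pos hΔ0 (2 * k + 1)).le
    linarith
  obtain ⟨hX0, hXY⟩ := mul_expect_trace_pow_le hVpsd hB hB1 hBμ hμ0
    (by positivity : 0 < Δ * (2 + s)) (by positivity : 0 ≤ Δ * (2 + s / 2)) hBV k hk'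
  have hRR : ∀ x, V x ^ k * (V x ^ k)ᵀ = V x ^ (2 * k) := by
    intro x
    rw [transpose_pow, (hVpsd x).1.transpose_eq, ← pow_add, two_mul]
  -- With `η = s / 8` the term `2η` consumes half of the gap `s / 2`; the other half is left for the
  -- high-degree error.
  have hlow := hD.expect_expect_trace_ge hmn hn hΔ hΔ0.le hA (a := 4 * Fintype.card ι)
    (by positivity) hAtr hA2 (R := fun x => V x ^ k) (K := k * m)
    (CubeDegreeLE.matrix_pow hVdeg k) (η := s / 8) (by positivity)
  simp only [hRR, ← hWtr] at hlow
  have hup : 𝔼 x, (W x * V x ^ (2 * k)).trace ≤ -(Δ * (s / 2) * 𝔼 x, (V x ^ (2 * k)).trace) := by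
    have h1 : ∀ x, (W x * V x ^ (2 * k)).trace =
        2 * Δ * (V x ^ (2 * k)).trace - (V x ^ (2 * k + 1)).trace := fun x => by
      rw [pow_succ', hVtr]; ring
    simp only [h1, Finset.expect_sub_distrib, ← Finset.mul_expect]
    linarith
  set p := (((k * m : ℕ) : ℝ) * m / n) ^ (d / 2 + 1)
  set X := 𝔼 x, (V x ^ (2 * k)).trace
  have hp : 0 ≤ p := by positivity
  have h1 : s / 2 ≤ s / 8 * 2 + (1 + 1 / (s / 8)) * (4 * Fintype.card ι * p) := by
    have h2 : Δ * X * (s / 2) ≤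
        Δ * X * (s / 8 * 2 + (1 + 1 / (s / 8)) * (4 * Fintype.card ι * p)) := by
      linarith
    exact le_of_mul_le_mul_left h2 (mul_pos hΔ0 hX0)
  have h2 : (1 + 1 / (s / 8)) ≤ 9 / s := by
    rw [one_div_div, ← sub_nonneg]
    have : 9 / s - (1 + 8 / s) = (1 - s) / s := by field_simp; ring
    rw [this]
    exact div_nonneg (by linarith) hs0.le
  have h3 : 4 * (Fintype.card ι : ℝ) * p ≤ 4 * r * p := by gcongr
  have h4 : s / 4 ≤ 9 / s * (4 * r * p) := by
    have := mul_le_mul h2 h3 (by positivity) (by positivity)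
    linarith
  have h5 := mul_le_mul_of_nonneg_left h4 (by positivity : 0 ≤ 4 * s)
  have h6 : 4 * s * (9 / s * (4 * r * p)) = 144 * r * p := by field_simp; ring
  rw [h6] at h5
  linarith

/-! ### The lower bound from a pseudo-density -/

/-- For `s ≤ 1` the ratio `(2 + s) / (2 + s/2)` is at least `exp (s / 10)`. -/
theorem mul_pow_le_of_le_exp {ρ μ s N a : ℝ} {j : ℕ} (hμ : 0 < μ) (hs0 : 0 < s) (hs1 : s ≤ 1)
    (hρ : ρ ≤ Real.exp a) (hN : Real.exp (-N) ≤ μ) (hj : a + N ≤ j * (s / 10)) :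
    ρ * (2 + s / 2) ^ j ≤ μ * (2 + s) ^ j := by
  have h1 : Real.exp (s / 10) ≤ 1 + s / 5 := by
    have h2 := Real.one_sub_le_exp_neg (s / 10)
    rw [Real.exp_neg] at h2
    have h3 := Real.exp_pos (s / 10)
    have h4 : (1 - s / 10) * Real.exp (s / 10) ≤ 1 := by
      calc _ ≤ (Real.exp (s / 10))⁻¹ * Real.exp (s / 10) := mul_le_mul_of_nonneg_right h2 h3.le
        _ = 1 := inv_mul_cancel₀ h3.ne'
    nlinarith
  have h2 : Real.exp (s / 10) * (2 + s / 2) ≤ 2 + s := by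
    have := mul_le_mul_of_nonneg_right h1 (by positivity : 0 ≤ 2 + s / 2)
    nlinarith
  have h3 : ρ ≤ μ * Real.exp (s / 10) ^ j := by
    rw [← Real.exp_nat_mul]
    calc ρ ≤ Real.exp a := hρ
      _ = Real.exp (-N) * Real.exp (a + N) := by rw [← Real.exp_add]; ring_nf
      _ ≤ _ := mul_le_mul hN (Real.exp_le_exp.mpr hj) (Real.exp_pos _).le hμ.le
  calc ρ * (2 + s / 2) ^ j ≤ μ * Real.exp (s / 10) ^ j * (2 + s / 2) ^ j :=
        mul_le_mul_of_nonneg_right h3 (by positivity)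
    _ = μ * (Real.exp (s / 10) * (2 + s / 2)) ^ j := by rw [mul_pow]; ring
    _ ≤ _ := by gcongr

theorem rpow_mul_le_of_forall {n m d r : ℕ} {e μ s Q : ℝ} (hm : 1 ≤ m) (hd : 1 ≤ d) (hn : 2 ≤ n)
    (he0 : 0 < e) (heμ : e < μ) (hμ1 : μ ≤ 1) (hs : s = e / μ) (hr1 : (1 : ℝ) ≤ r) (hQ0 : 0 ≤ Q)
    (hQe : Q * (d * (m : ℝ) ^ 2 * Real.log n) = 1 / 1728 * e * n)
    (core : ∀ k : ℕ, r * (2 + s / 2) ^ (2 * k + 1) ≤ μ * (2 + s) ^ (2 * k + 1) →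
      s ^ 2 ≤ 144 * r * (((k * m : ℕ) : ℝ) * m / n) ^ (d / 2 + 1)) :
    Q ^ ((d : ℝ) / 4) * (e ^ ((3 : ℝ) / 2) * √μ) ≤ r := by
  have hμ0 : 0 < μ := by linarith
  have he1 : e ≤ 1 := by linarith
  have hs0 : 0 < s := by rw [hs]; exact div_pos he0 hμ0
  have hs1 : s ≤ 1 := by rw [hs, div_le_one hμ0]; exact heμ.le
  have hes : e ≤ s := by rw [hs, le_div_iff₀ hμ0]; exact mul_le_of_le_one_right he0.le hμ1
  have hn2 : (2 : ℝ) ≤ n := by exact_mod_cast hn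
  have hL : 1 / 2 ≤ Real.log n := by
    have := Real.log_le_log (by norm_num) hn2
    have := Real.log_two_gt_d9
    linarith
  set L := Real.log n with hLdef
  have hnL : (n : ℝ) = Real.exp L := (Real.exp_log (by linarith)).symm
  have hd1 : (1 : ℝ) ≤ d := by exact_mod_cast hd
  have hm1 : (1 : ℝ) ≤ (m : ℝ) ^ 2 := one_le_pow₀ (by exact_mod_cast hm)
  have hdm : 1 ≤ d * (m : ℝ) ^ 2 := one_le_mul_of_one_le_of_one_le hd1 hm1
  have hden : 1 / 2 ≤ d * (m : ℝ) ^ 2 * L :=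
    hL.trans (le_mul_of_one_le_left (by linarith) hdm)
  have hX : e ^ ((3 : ℝ) / 2) * √μ ≤ s := by
    have h1 : e ^ ((3 : ℝ) / 2) ≤ e ^ (1 : ℝ) :=
      Real.rpow_le_rpow_of_exponent_ge he0 he1 (by norm_num)
    rw [Real.rpow_one] at h1
    have h2 : √μ ≤ 1 := Real.sqrt_le_one.mpr hμ1
    calc _ ≤ e * 1 := mul_le_mul h1 h2 (Real.sqrt_nonneg _) he0.le
      _ ≤ s := by linarith
  have hd4 : (0 : ℝ) ≤ (d : ℝ) / 4 := by positivity
  have hQd0 : 0 ≤ Q ^ ((d : ℝ) / 4) := Real.rpow_nonneg hQ0 _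
  have hgoal : Q ^ ((d : ℝ) / 4) * s ≤ r → Q ^ ((d : ℝ) / 4) * (e ^ ((3 : ℝ) / 2) * √μ) ≤ r :=
    fun h => (mul_le_mul_of_nonneg_left hX hQd0).trans h
  apply hgoal
  -- The cases `Q ≤ 1` and `r ≥ n ^ (d/4)` are immediate. Otherwise `log r` is at most `(d/4) log
  -- n`, and `Q > 1` forces `μ > e ≥ 1 / n`, so a `k` of order `d log n / e` is admissible.
  rcases le_or_gt Q 1 with hQ1 | hQ1
  · calc _ ≤ 1 * 1 := mul_le_mul (Real.rpow_le_one hQ0 hQ1 hd4) hs1 hs0.le zero_le_one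
      _ ≤ r := by linarith
  rcases le_or_gt ((n : ℝ) ^ ((d : ℝ) / 4)) r with hrn | hrn
  · have hQn : Q ≤ n := by
      have : (1 / 1728 * e) * n ≤ 1 / 2 * n :=
        mul_le_mul_of_nonneg_right (by linarith) (by linarith)
      have := mul_le_mul_of_nonneg_left hden hQ0
      linarith
    calc _ ≤ (n : ℝ) ^ ((d : ℝ) / 4) * 1 :=
          mul_le_mul (Real.rpow_le_rpow hQ0 hQn hd4) hs1 hs0.le (by positivity)
      _ ≤ r := by linarith
  set k := ⌈10 * d * L / e⌉₊ with hk
  have hLd : 1 / 2 ≤ d * L := hL.trans (le_mul_of_one_le_left (by linarith) hd1)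
  have hk1 : 10 * d * L / e ≤ k := Nat.le_ceil _
  have hk2 : (k : ℝ) ≤ 12 * d * L / e := by
    have h1 : (k : ℝ) < 10 * d * L / e + 1 := Nat.ceil_lt_add_one (by positivity)
    have h2 : 1 ≤ 2 * d * L / e := by rw [le_div_iff₀ he0]; linarith
    have h3 : 12 * d * L / e = 10 * d * L / e + 2 * d * L / e := by ring
    linarith
  have hen : 1 ≤ e * n := by
    have : d * (m : ℝ) ^ 2 * L ≤ Q * (d * (m : ℝ) ^ 2 * L) :=
      le_mul_of_one_le_left (by linarith) hQ1.le
    linarith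
  have hcond : r * (2 + s / 2) ^ (2 * k + 1) ≤ μ * (2 + s) ^ (2 * k + 1) := by
    refine mul_pow_le_of_le_exp (a := d / 4 * L) (N := L) hμ0 hs0 hs1 ?_ ?_ ?_
    · rw [mul_comm, Real.exp_mul, ← hnL]
      exact hrn.le
    · rw [Real.exp_neg, ← hnL, inv_le_iff_one_le_mul₀ (by linarith)]
      exact hen.trans (mul_le_mul_of_nonneg_right heμ.le (by linarith))
    · have h1 : 10 * d * L ≤ k * s := by
        rw [div_le_iff₀ he0] at hk1
        have : (k : ℝ) * e ≤ k * s := by gcongr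
        linarith
      have h2 : L ≤ d * L := le_mul_of_one_le_left (by linarith) hd1
      push_cast
      linarith
  have h1 := core k hcond
  set h := d / 2 + 1 with hh
  -- The constant is `1728 = 12 · 144`: the `12` comes from `hk2`, and the `144` cancels the one in
  -- `core`.
  have hy : ((k * m : ℕ) : ℝ) * m / n ≤ 1 / 144 / Q := by
    rw [div_le_div_iff₀ (by linarith) (by linarith)]
    push_cast
    calc (k : ℝ) * m * m * Q = k * (m ^ 2 * Q) := by ring
      _ ≤ 12 * d * L / e * (m ^ 2 * Q) := by gcongr
      _ = 12 / e * (Q * (d * m ^ 2 * L)) := by ring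
      _ = 1 / 144 * n := by rw [hQe]; field_simp; norm_num
  have h2 : (((k * m : ℕ) : ℝ) * m / n) ^ h ≤ 1 / 144 / Q ^ ((d : ℝ) / 2) := by
    calc _ ≤ (1 / 144 / Q) ^ h := by gcongr
      _ = (1 / 144) ^ h / Q ^ h := div_pow _ _ _
      _ ≤ 1 / 144 / Q ^ ((d : ℝ) / 2) := by
          refine div_le_div₀ (by norm_num) ?_ (by positivity) ?_
          · rw [hh, pow_succ]
            exact mul_le_of_le_one_left (by norm_num) (pow_le_one₀ (by norm_num) (by norm_num))
          · rw [← Real.rpow_natCast]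
            refine Real.rpow_le_rpow_of_exponent_le hQ1.le ?_
            have : d ≤ 2 * h := by omega
            have : (d : ℝ) ≤ 2 * h := by exact_mod_cast this
            linarith
  have hQd : 0 < Q ^ ((d : ℝ) / 2) := Real.rpow_pos_of_pos (by linarith) _
  have h3 : s ^ 2 * Q ^ ((d : ℝ) / 2) ≤ r := by
    have h4 : s ^ 2 ≤ 144 * r * (1 / 144 / Q ^ ((d : ℝ) / 2)) :=
      h1.trans (mul_le_mul_of_nonneg_left h2 (by positivity))
    have h5 : 144 * (r : ℝ) * (1 / 144 / Q ^ ((d : ℝ) / 2)) = r / Q ^ ((d : ℝ) / 2) := by ring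
    rwa [h5, le_div_iff₀ hQd] at h4
  have h4 : (Q ^ ((d : ℝ) / 4)) ^ 2 = Q ^ ((d : ℝ) / 2) := by
    rw [← Real.rpow_natCast, ← Real.rpow_mul hQ0]
    congr 1
    push_cast
    ring
  -- `h3` is stronger than needed: the claim follows from it through `r ≤ r²`.
  refine le_of_sq_le_sq ?_ (by linarith)
  rw [mul_pow, h4, mul_comm, sq (r : ℝ)]
  exact h3.trans (le_mul_of_one_le_left (by linarith) hr1)

theorem le_of_hasPsdFactorization {n m d r : ℕ} (hm : 1 ≤ m) (hd : 1 ≤ d) (hn : 2 * m ≤ n)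
    {f D : Cube m → ℝ} (hf : ∀ x, f x ∈ Set.Icc (0 : ℝ) 1) (hD : IsPseudoDensity d D) {Δ ε : ℝ}
    (hΔ : ∀ y, |D y| ≤ Δ) (hε : 0 < ε) (hDf : 𝔼 x, D x * f x < -ε)
    (hr : HasPsdFactorization (restrictionMatrix n f) r) :
    (1 / 1728 * ε * n / (d * (m : ℝ) ^ 2 * Δ * Real.log n)) ^ ((d : ℝ) / 4) *
      (ε / Δ) ^ ((3 : ℝ) / 2) * √(𝔼 x, f x) ≤ r := by
  have hΔ1 : 1 ≤ Δ := by
    rw [← hD.expect_eq_one, ← Finset.expect_const (Finset.univ_nonempty (α := Cube m)) Δ]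
    exact Finset.expect_le_expect fun x _ => (le_abs_self _).trans (hΔ x)
  have hΔ0 : 0 < Δ := by linarith
  set μ := 𝔼 x, f x with hμ
  have hεμ : ε < Δ * μ := by
    have : -(Δ * μ) ≤ 𝔼 x, D x * f x := by
      rw [hμ, Finset.mul_expect, ← Finset.expect_neg_distrib]
      refine Finset.expect_le_expect fun x _ => ?_
      have h1 := (abs_le.mp (hΔ x)).1
      nlinarith [(hf x).1]
    linarith
  have hμ0 : 0 < μ := by
    by_contra h
    nlinarith
  have hμ1 : μ ≤ 1 := by
    rw [hμ, ← Finset.expect_const (Finset.univ_nonempty (α := Cube m)) (1 : ℝ)]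
    exact Finset.expect_le_expect fun x _ => (hf x).2
  set e := ε / Δ with he
  have he0 : 0 < e := div_pos hε hΔ0
  have heμ : e < μ := by rw [he, div_lt_iff₀ hΔ0]; linarith
  set s := e / μ with hs
  have hs0 : 0 < s := div_pos he0 hμ0
  have hs1 : s ≤ 1 := by rw [hs, div_le_one hμ0]; exact heμ.le
  have hsε : s * (Δ * μ) = ε := by rw [hs, he]; field_simp
  have hmn : m ≤ n := by omega
  have hn0 : 0 < n := by omega
  have core := sq_le_of_hasPsdFactorization hmn hn0 hf hD hΔ hΔ0 hμ0 hs0 hs1 hsε hDf hr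
  -- For `r = 0` the condition on `k` holds trivially, and `core 0` would give `s² ≤ 0`.
  have hr1 : (1 : ℝ) ≤ r := by
    rcases Nat.eq_zero_or_pos r with rfl | h
    · have h1 := core 0 (by simp only [Nat.cast_zero, zero_mul]; positivity)
      simp only [Nat.cast_zero, mul_zero, zero_mul] at h1
      nlinarith
    · exact_mod_cast h
  have hdm : (d : ℝ) * (m : ℝ) ^ 2 ≠ 0 := by positivity
  have hL : Real.log n ≠ 0 := (Real.log_pos (by exact_mod_cast (by omega : 1 < n))).ne'
  rw [mul_assoc]
  refine rpow_mul_le_of_forall hm hd (by omega) he0 heμ hμ1 hs hr1 ?_ ?_ core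
  · have := Real.log_nonneg (x := n) (by exact_mod_cast (by omega : 1 ≤ n))
    positivity
  · rw [he]; field_simp

/-! ### The upper bound from a certificate -/

open Matrix in
theorem hasPsdFactorization_of_fintype {I J ι : Type*} [Fintype ι] {M : Matrix I J ℝ}
    {A : I → Matrix ι ι ℝ} {B : J → Matrix ι ι ℝ} (hA : ∀ i, (A i).PosSemidef)
    (hB : ∀ j, (B j).PosSemidef) (hM : ∀ i j, M i j = (A i * B j).trace) :
    HasPsdFactorization M (Fintype.card ι) := by
  classical
  let e := (Fintype.equivFin ι).symm
  refine ⟨fun i => (A i).submatrix e e, fun j => (B j).submatrix e e,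
    fun i => (hA i).submatrix e, fun j => (hB j).submatrix e, fun i j => ?_⟩
  rw [submatrix_mul_equiv, hM]
  exact (Equiv.sum_comp e fun a => (A i * B j) a a).symm

theorem sum_subtype_cubeFourier {n k : ℕ} {g : Cube n → ℝ} (hg : CubeDegreeLE k g)
    (F : ℝ → Finset (Fin n) → ℝ) (hF : ∀ T, F 0 T = 0) :
    ∑ T : {T : Finset (Fin n) // #T ≤ k}, F (cubeFourier g T.1) T.1 =
      ∑ T, F (cubeFourier g T) T := by
  rw [← Finset.sum_filter_of_ne (p := fun T : Finset (Fin n) => #T ≤ k) fun T _ hT => ?_]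
  · exact (Finset.sum_subtype _ (by simp) fun T => F (cubeFourier g T) T).symm
  · by_contra h
    exact hT (by rw [hg T (not_le.mp h), hF])

-- The left factor at `S` is the Gram sum of the Fourier vectors of the `g j` read on `S`; the right
-- factor at `x` is the rank-one matrix of the character vector. Restriction to `S` does not raise
-- the degree.
open Matrix in
theorem hasPsdFactorization_of_hasSosCertificate {n m d : ℕ} {f : Cube m → ℝ}
    (hf : HasSosCertificate f d) : HasPsdFactorization (restrictionMatrix n f)
      (Fintype.card {T : Finset (Fin n) // #T ≤ d / 2}) := by
  obtain ⟨t, g, hg, hfg⟩ := hf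
  let c : SubsetOfCard n m → Fin t → {T : Finset (Fin n) // #T ≤ d / 2} → ℝ :=
    fun S j T => cubeFourier (fun x => g j (cubeRestrict S x)) T.1
  let χ : Cube n → {T : Finset (Fin n) // #T ≤ d / 2} → ℝ := fun x T => cubeChar T.1 x
  refine hasPsdFactorization_of_fintype (A := fun S => ∑ j, vecMulVec (c S j) (c S j))
    (B := fun x => vecMulVec (χ x) (χ x)) (fun S => posSemidef_sum _ fun j _ => ?_)
    (fun x => ?_) fun S x => ?_
  · simpa using posSemidef_vecMulVec_self_star (c S j)
  · simpa using posSemidef_vecMulVec_self_star (χ x)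
  · rw [Matrix.sum_mul, trace_sum, restrictionMatrix, of_apply, hfg]
    refine Finset.sum_congr rfl fun j _ => ?_
    have h1 : c S j ⬝ᵥ χ x = g j (cubeRestrict S x) := by
      rw [← sum_cubeFourier_mul_cubeChar (fun x => g j (cubeRestrict S x)) x]
      exact sum_subtype_cubeFourier ((two_mul_cubeDegree_le_iff.mp (hg j)).comp_cubeRestrict S)
        (fun a T => a * cubeChar T x) fun T => zero_mul _
    rw [mul_vecMulVec, trace_vecMulVec, vecMulVec_mulVec]
    simp [smul_dotProduct, h1, sq]

/-- Every nonempty set of size at most `k` is the image of a map `Fin k → Fin n`; the empty set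
accounts for the `1`. -/
theorem card_subtype_card_le (n k : ℕ) :
    Fintype.card {T : Finset (Fin n) // #T ≤ k} ≤ 1 + n ^ k := by
  classical
  have h1 : (Finset.univ.filter fun T : Finset (Fin n) => #T ≤ k) ⊆
      insert ∅ (Finset.univ.image fun g : Fin k → Fin n => Finset.univ.image g) := by
    intro T hT
    have hT := (Finset.mem_filter.mp hT).2
    rcases T.eq_empty_or_nonempty with rfl | hne
    · exact Finset.mem_insert_self _ _
    refine Finset.mem_insert_of_mem (Finset.mem_image.mpr ?_)
    have : Nonempty T := hne.to_subtype
    obtain ⟨φ⟩ : Nonempty (T ↪ Fin k) := Function.Embedding.nonempty_of_card_le (by simpa using hT)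
    refine ⟨fun i => (Function.invFun φ i).1, Finset.mem_univ _, ?_⟩
    ext i
    simp only [Finset.mem_image, Finset.mem_univ, true_and]
    constructor
    · rintro ⟨j, rfl⟩
      exact (Function.invFun φ j).2
    · intro hi
      obtain ⟨j, hj⟩ := Function.invFun_surjective φ.injective ⟨i, hi⟩
      exact ⟨j, by rw [hj]⟩
  rw [Fintype.card_subtype]
  refine (Finset.card_le_card h1).trans ((Finset.card_insert_le _ _).trans ?_)
  have := Finset.card_image_le (s := Finset.univ) (f := fun g : Fin k → Fin n => Finset.univ.image g)
  rw [Finset.card_univ, Fintype.card_fun, Fintype.card_fin, Fintype.card_fin] at this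
  omega

/-! ### Duality between certificates and pseudo-densities -/

/-- The quadratic form with matrix `Q` evaluated at the characters of degree at most `k`. -/
noncomputable def cubeQuadratic {m : ℕ} (k : ℕ)
    (Q : Matrix {T : Finset (Fin m) // #T ≤ k} {T : Finset (Fin m) // #T ≤ k} ℝ) (x : Cube m) : ℝ :=
  ∑ S, ∑ T, Q S T * (cubeChar S.1 x * cubeChar T.1 x)

theorem cubeQuadratic_transpose_mul_self {m k : ℕ}
    (C : Matrix {T : Finset (Fin m) // #T ≤ k} {T : Finset (Fin m) // #T ≤ k} ℝ) (x : Cube m) :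
    cubeQuadratic k (Cᵀ * C) x = ∑ i, (∑ T, C i T * cubeChar T.1 x) ^ 2 := by
  simp only [cubeQuadratic, Matrix.mul_apply, Matrix.transpose_apply, Finset.sum_mul]
  rw [Finset.sum_comm_cycle]
  refine Finset.sum_congr rfl fun i _ => ?_
  rw [sq, Finset.sum_mul_sum]
  refine Finset.sum_congr rfl fun S _ => Finset.sum_congr rfl fun T _ => ?_
  ring

/-- The normalized sums of squares of functions of degree at most `k`. -/
def normalizedSos (m k : ℕ) : Set (Cube m → ℝ) :=
  cubeQuadratic k '' {Q | Q.PosSemidef ∧ Q.trace = 1}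

theorem convex_normalizedSos (m k : ℕ) : Convex ℝ (normalizedSos m k) := by
  rintro _ ⟨P, ⟨hP, hP1⟩, rfl⟩ _ ⟨Q, ⟨hQ, hQ1⟩, rfl⟩ a b ha hb hab
  refine ⟨a • P + b • Q, ⟨(hP.smul ha).add (hQ.smul hb), ?_⟩, ?_⟩
  · rw [Matrix.trace_add, Matrix.trace_smul, Matrix.trace_smul, hP1, hQ1]
    simpa using hab
  · funext x
    simp only [cubeQuadratic, Matrix.add_apply, Matrix.smul_apply, Pi.add_apply, Pi.smul_apply,
      smul_eq_mul, Finset.mul_sum, ← Finset.sum_add_distrib]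
    refine Finset.sum_congr rfl fun S _ => Finset.sum_congr rfl fun T _ => ?_
    ring

/-- Since `Tr (CᵀC)` is the squared Frobenius norm of `C`, the set is a continuous image of a
Euclidean unit sphere. -/
theorem isCompact_normalizedSos (m k : ℕ) : IsCompact (normalizedSos m k) := by
  let ι := {T : Finset (Fin m) // #T ≤ k}
  let K : Set (ι → ι → ℝ) := {C | ∑ i, ∑ j, C i j ^ 2 = 1}
  have hK : IsCompact K := by
    refine Metric.isCompact_of_isClosed_isBounded (isClosed_eq (by fun_prop) continuous_const) ?_
    refine (Metric.isBounded_closedBall (x := (0 : ι → ι → ℝ)) (r := 1)).subset fun C hC => ?_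
    rw [mem_closedBall_zero_iff, pi_norm_le_iff_of_nonneg zero_le_one]
    intro i
    rw [pi_norm_le_iff_of_nonneg zero_le_one]
    intro j
    have h1 : C i j ^ 2 ≤ ∑ j, C i j ^ 2 :=
      Finset.single_le_sum (f := fun j => C i j ^ 2) (fun j _ => sq_nonneg _) (Finset.mem_univ j)
    have h2 : ∑ j, C i j ^ 2 ≤ ∑ i, ∑ j, C i j ^ 2 :=
      Finset.single_le_sum (f := fun i => ∑ j, C i j ^ 2)
        (fun i _ => Finset.sum_nonneg fun j _ => sq_nonneg _) (Finset.mem_univ i)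
    rw [Real.norm_eq_abs, ← sq_le_one_iff_abs_le_one]
    exact (h1.trans h2).trans_eq hC
  have himg : normalizedSos m k =
      (fun (C : ι → ι → ℝ) (x : Cube m) => ∑ i, (∑ T, C i T * cubeChar T.1 x) ^ 2) '' K := by
    ext h
    constructor
    · rintro ⟨Q, ⟨hQ, hQ1⟩, rfl⟩
      obtain ⟨C, rfl⟩ := hQ.exists_transpose_mul_self
      rw [Matrix.trace_transpose_mul_self] at hQ1
      exact ⟨C, hQ1, funext fun x => (cubeQuadratic_transpose_mul_self _ x).symm⟩
    · rintro ⟨C, hC, rfl⟩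
      refine ⟨(Matrix.of C)ᵀ * Matrix.of C, ⟨?_, ?_⟩, funext fun x =>
        cubeQuadratic_transpose_mul_self _ x⟩
      · simpa using Matrix.posSemidef_conjTranspose_mul_self (Matrix.of C)
      · rw [Matrix.trace_transpose_mul_self]
        exact hC
  rw [himg]
  exact hK.image (by fun_prop)

theorem sq_div_mem_normalizedSos {m k : ℕ} {g : Cube m → ℝ} (hg : CubeDegreeLE k g)
    (h0 : 𝔼 x, g x ^ 2 ≠ 0) : (fun x => g x ^ 2 / 𝔼 x, g x ^ 2) ∈ normalizedSos m k := by
  let c : {T : Finset (Fin m) // #T ≤ k} → ℝ := fun T => cubeFourier g T.1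
  have hpos : 0 < 𝔼 x, g x ^ 2 :=
    lt_of_le_of_ne (Finset.expect_nonneg fun x _ => sq_nonneg _) h0.symm
  refine ⟨(𝔼 x, g x ^ 2)⁻¹ • Matrix.vecMulVec c c, ⟨Matrix.PosSemidef.smul ?_
    (inv_nonneg.mpr hpos.le), ?_⟩, funext fun x => ?_⟩
  · simpa using Matrix.posSemidef_vecMulVec_self_star c
  · have h1 : c ⬝ᵥ c = 𝔼 x, g x ^ 2 := by
      rw [expect_sq_eq_sum_cubeFourier_sq]
      simp only [sq]
      exact sum_subtype_cubeFourier hg (fun a _ => a * a) fun _ => zero_mul _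
    rw [Matrix.trace_smul, Matrix.trace_vecMulVec, h1, smul_eq_mul, inv_mul_cancel₀ h0]
  · have h1 : ∑ T, c T * cubeChar T.1 x = g x := by
      rw [← sum_cubeFourier_mul_cubeChar g x]
      exact sum_subtype_cubeFourier hg (fun a T => a * cubeChar T x) fun _ => zero_mul _
    simp only [cubeQuadratic, Matrix.smul_apply, Matrix.vecMulVec_apply, smul_eq_mul]
    rw [← h1, sq, Finset.sum_mul_sum, div_eq_inv_mul, Finset.mul_sum]
    refine Finset.sum_congr rfl fun S _ => ?_
    rw [Finset.mul_sum]
    refine Finset.sum_congr rfl fun T _ => ?_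
    ring

theorem hasSosCertificate_of_div_mem {m d : ℕ} {f : Cube m → ℝ} {a : ℝ} (ha : 0 < a)
    (h : (fun x => f x / a) ∈ normalizedSos m (d / 2)) : HasSosCertificate f d := by
  obtain ⟨Q, ⟨hQ, -⟩, hQf⟩ := h
  obtain ⟨C, rfl⟩ := hQ.exists_transpose_mul_self
  let e := (Fintype.equivFin {T : Finset (Fin m) // #T ≤ d / 2}).symm
  refine ⟨_, fun j x => √a * ∑ T, C (e j) T * cubeChar T.1 x, fun j => ?_, fun x => ?_⟩
  · rw [two_mul_cubeDegree_le_iff]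
    exact (CubeDegreeLE.sum fun T _ => (CubeDegreeLE.of_card_le T.2).const_mul _).const_mul _
  · have h1 := congrFun hQf x
    rw [cubeQuadratic_transpose_mul_self, eq_div_iff ha.ne'] at h1
    simp only [mul_pow, Real.sq_sqrt ha.le]
    rw [← Finset.mul_sum, Equiv.sum_comp e fun i => (∑ T, C i T * cubeChar T.1 x) ^ 2, mul_comm, h1]

/-- By orthonormality of the characters, trace `1` means expectation `1`. Without a certificate, `f
/ 𝔼 f` lies outside a compact convex set and can be strictly separated from it. -/
theorem exists_isPseudoDensity {m d : ℕ} {f : Cube m → ℝ} (hf : ∀ x, 0 ≤ f x)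
    (hsos : ¬HasSosCertificate f d) : ∃ D, IsPseudoDensity d D ∧ 𝔼 x, D x * f x < 0 := by
  have hf0 : 0 < 𝔼 x, f x := by
    refine lt_of_le_of_ne (Finset.expect_nonneg fun x _ => hf x) fun h => hsos ?_
    have h1 := (Finset.expect_eq_zero_iff_of_nonneg fun x _ => hf x).mp h.symm
    exact ⟨0, Fin.elim0, fun j => j.elim0, fun x => by simp [h1 x (Finset.mem_univ x)]⟩
  obtain ⟨l, u, hlu, hul⟩ := geometric_hahn_banach_point_closed
    (convex_normalizedSos m (d / 2)) (isCompact_normalizedSos m (d / 2)).isClosed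
    fun h => hsos (hasSosCertificate_of_div_mem hf0 h)
  -- The density of `l` under the uniform measure, shifted by `u`: on functions of mean `1` the
  -- affine separation becomes the sign of `𝔼 D₁ h`. Strictness makes `𝔼 D₁` positive, so that `D₁`
  -- can be normalized.
  let D₁ : Cube m → ℝ := fun x => 2 ^ m * l (Pi.single x 1) - u
  have hD₁ : ∀ h : Cube m → ℝ, 𝔼 x, D₁ x * h x = l h - u * 𝔼 x, h x := by
    intro h
    have h1 : l h = 𝔼 x, 2 ^ m * l (Pi.single x 1) * h x := by
      have h2 : h = ∑ x, h x • Pi.single x (1 : ℝ) := by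
        funext y
        simp [Finset.sum_apply, Pi.single_apply]
      conv_lhs => rw [h2, map_sum]
      rw [Fintype.expect_eq_sum_div_card, Finset.sum_div]
      refine Finset.sum_congr rfl fun x _ => ?_
      rw [map_smul, smul_eq_mul]
      have h3 : (Fintype.card (Cube m) : ℝ) = 2 ^ m := by simp
      rw [h3]
      field_simp
    rw [h1, Finset.mul_expect, ← Finset.expect_sub_distrib]
    exact Finset.expect_congr rfl fun x _ => by simp only [D₁]; ring
  have hsq : ∀ g : Cube m → ℝ, CubeDegreeLE (d / 2) g → 𝔼 x, g x ^ 2 ≠ 0 →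
      0 < 𝔼 x, D₁ x * g x ^ 2 := by
    intro g hg h0
    have hpos : 0 < 𝔼 x, g x ^ 2 :=
      lt_of_le_of_ne (Finset.expect_nonneg fun x _ => sq_nonneg _) h0.symm
    have h1 := hul _ (sq_div_mem_normalizedSos hg h0)
    have h2 := hD₁ fun x => g x ^ 2 / 𝔼 x, g x ^ 2
    simp only [← Finset.expect_div, ← mul_div_assoc] at h2
    rw [mul_div_cancel_right₀ _ h0, div_eq_iff h0] at h2
    rw [h2]
    exact mul_pos (by linarith) hpos
  have hone : 0 < 𝔼 x, D₁ x := by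
    have := hsq (fun _ => 1) (CubeDegreeLE.const 1) (by simp)
    simpa using this
  have hneg : 𝔼 x, D₁ x * f x < 0 := by
    have h2 := hD₁ fun x => f x / 𝔼 x, f x
    simp only [← Finset.expect_div, ← mul_div_assoc] at h2
    rw [mul_div_cancel_right₀ _ hf0.ne', div_eq_iff hf0.ne'] at h2
    rw [h2]
    exact mul_neg_of_neg_of_pos (by linarith) hf0
  refine ⟨fun x => (𝔼 x, D₁ x)⁻¹ * D₁ x, ⟨?_, fun g hg => ?_⟩, ?_⟩
  · rw [← Finset.mul_expect, inv_mul_cancel₀ hone.ne']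
  · simp only [mul_assoc]
    rw [← Finset.mul_expect]
    refine mul_nonneg (inv_nonneg.mpr hone.le) ?_
    by_cases h0 : 𝔼 x, g x ^ 2 = 0
    · have h1 := (Finset.expect_eq_zero_iff_of_nonneg fun x _ => sq_nonneg (g x)).mp h0
      exact Finset.expect_nonneg fun x hx => by rw [h1 x hx, mul_zero]
    · exact (hsq g (two_mul_cubeDegree_le_iff.mp hg) h0).le
  · simp only [mul_assoc]
    rw [← Finset.mul_expect]
    exact mul_neg_of_pos_of_neg (inv_pos.mpr hone) hneg

/-! ### The psd rank of restriction matrices -/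

theorem hasPsdFactorization_psdRank {n m : ℕ} {f : Cube m → ℝ} (hf : ∀ x, 0 ≤ f x) :
    HasPsdFactorization (restrictionMatrix n f) (psdRank (restrictionMatrix n f)) :=
  Nat.sInf_mem (exists_hasPsdFactorization _ fun _ _ => hf _)

theorem psdRank_restrictionMatrix_le {n m d : ℕ} {f : Cube m → ℝ} (hf : ∀ x, 0 ≤ f x)
    (hd : d + 2 = sosDegree f) (hn : 1 ≤ n) :
    (psdRank (restrictionMatrix n f) : ℝ) ≤ 1 + (n : ℝ) ^ (1 + (d : ℝ) / 2) := by
  have hcert : HasSosCertificate f (d + 2) := by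
    rw [hd]
    exact Nat.sInf_mem (exists_hasSosCertificate f hf)
  have h1 : psdRank (restrictionMatrix n f) ≤ 1 + n ^ ((d + 2) / 2) :=
    (Nat.sInf_le (hasPsdFactorization_of_hasSosCertificate hcert)).trans
      (card_subtype_card_le _ _)
  have h2 : (psdRank (restrictionMatrix n f) : ℝ) ≤ 1 + (n : ℝ) ^ ((d + 2) / 2) := by
    exact_mod_cast h1
  refine h2.trans (add_le_add le_rfl ?_)
  rw [← Real.rpow_natCast]
  refine Real.rpow_le_rpow_of_exponent_le (by exact_mod_cast hn) ?_
  have h3 : (((d + 2) / 2 : ℕ) : ℝ) ≤ ((d + 2 : ℕ) : ℝ) / 2 := Nat.cast_div_le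
  push_cast at h3
  linarith

theorem psdRank_restrictionMatrix_ge {n m d : ℕ} (hm : 1 ≤ m) (hd : 1 ≤ d) (hn : 2 * m ≤ n)
    {f D : Cube m → ℝ} (hf : ∀ x, f x ∈ Set.Icc (0 : ℝ) 1) (hD : IsPseudoDensity d D) {ε : ℝ}
    (hε : 0 < ε) (hDf : 𝔼 x, D x * f x < -ε) :
    (1 / 1728 * ε * n / (d * (m : ℝ) ^ 2 * (⨆ x, |D x|) * Real.log n)) ^ ((d : ℝ) / 4) *
      (ε / ⨆ x, |D x|) ^ ((3 : ℝ) / 2) * √(𝔼 x, f x) ≤ (psdRank (restrictionMatrix n f) : ℝ) :=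
  le_of_hasPsdFactorization hm hd hn hf hD
    (fun y => le_ciSup (f := fun x => |D x|) (Set.finite_range _).bddAbove y) hε hDf
    (hasPsdFactorization_psdRank fun x => (hf x).1)

theorem mainTheorem3 :
    (∀ (m d : ℕ), 1 ≤ m → 1 ≤ d → ∀ f : Cube m → ℝ, (∀ x, f x ∈ Set.Icc (0 : ℝ) 1) →
      d + 2 = sosDegree f →
      ∃ C : ℝ, 0 < C ∧ ∀ n : ℕ, 2 * m ≤ n →
        (psdRank (restrictionMatrix n f) : ℝ) ≤ 1 + (n : ℝ) ^ (1 + (d : ℝ) / 2) ∧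
        C * ((n : ℝ) / Real.log n) ^ ((d : ℝ) / 4) ≤ (psdRank (restrictionMatrix n f) : ℝ)) ∧
    (∃ c : ℝ, 0 < c ∧
      ∀ (m d : ℕ), 1 ≤ m → 1 ≤ d → ∀ f : Cube m → ℝ, (∀ x, f x ∈ Set.Icc (0 : ℝ) 1) →
      ∀ ε : ℝ, 0 < ε → ε ≤ 1 → ∀ D : Cube m → ℝ, IsPseudoDensity d D →
        𝔼 x : Cube m, D x * f x < -ε →
      ∀ n : ℕ, 2 * m ≤ n →
        (c * ε * n / (d * (m : ℝ) ^ 2 * (⨆ x, |D x|) * Real.log n)) ^ ((d : ℝ) / 4)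
            * (ε / ⨆ x, |D x|) ^ ((3 : ℝ) / 2) * √(𝔼 x : Cube m, f x)
          ≤ (psdRank (restrictionMatrix n f) : ℝ)) := by
  refine ⟨fun m d hm hd f hf hsos => ?_, 1 / 1728, by norm_num,
    fun m d hm hd f hf ε hε _ D hD hDf n hn => psdRank_restrictionMatrix_ge hm hd hn hf hD hε hDf⟩
  have hf0 : ∀ x, 0 ≤ f x := fun x => (hf x).1
  obtain ⟨D, hD, hDf⟩ := exists_isPseudoDensity (d := d) hf0 fun h => by
    have : sosDegree f ≤ d := Nat.sInf_le h
    omega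
  -- Half of the deficit, because the bound asks for the strict inequality `𝔼 D f < -ε`.
  set ε := -(𝔼 x, D x * f x) / 2 with hε
  have hε0 : 0 < ε := by linarith
  set Δ := ⨆ x, |D x| with hΔ
  have hΔD : ∀ y, |D y| ≤ Δ := fun y =>
    le_ciSup (f := fun x => |D x|) (Set.finite_range _).bddAbove y
  have hex : ∃ x, D x * f x ≠ 0 := by
    by_contra h
    push Not at h
    simp [h] at hDf
  obtain ⟨x₀, hx₀⟩ := hex
  have hΔ0 : 0 < Δ := (abs_pos.mpr (left_ne_zero_of_mul hx₀)).trans_le (hΔD x₀)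
  have hμ0 : 0 < 𝔼 x, f x := Finset.expect_pos' (fun x _ => hf0 x)
    ⟨x₀, Finset.mem_univ _, lt_of_le_of_ne (hf0 x₀) (right_ne_zero_of_mul hx₀).symm⟩
  refine ⟨(1 / 1728 * ε / (d * (m : ℝ) ^ 2 * Δ)) ^ ((d : ℝ) / 4) * (ε / Δ) ^ ((3 : ℝ) / 2) *
    √(𝔼 x, f x), by positivity, fun n hn =>
      ⟨psdRank_restrictionMatrix_le hf0 hsos (by omega), ?_⟩⟩
  have h := psdRank_restrictionMatrix_ge hm hd hn hf hD hε0 (by linarith)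
  refine le_trans (le_of_eq ?_) h
  have hlog : 0 ≤ Real.log n := Real.log_natCast_nonneg n
  have h1 : 1 / 1728 * ε * n / (d * (m : ℝ) ^ 2 * Δ * Real.log n) =
      (1 / 1728 * ε / (d * (m : ℝ) ^ 2 * Δ)) * (n / Real.log n) :=
    (div_mul_div_comm _ _ _ _).symm
  rw [h1, Real.mul_rpow (by positivity) (by positivity)]
  ring
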